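/- Let $p\ge 2$, $\alpha=p-1$ and $\theta\ge 0$ be real numbers. For $s\ge 0$ put $\omega_s=\dfrac{2\pi^{(s+1)/2}}{\Gamma((s+1)/2)}$ and let $\mathrm{d}\lambda_s=\omega_s r^{s}\,\mathrm{d}r$ on $(0,\infty)$; for $q\geq 1$ let $\|u\|_{L^q_s}=\big(\int_0^\infty|u|^q\,\mathrm{d}\lambda_s\big)^{1/q}$. Let $X$ be the set of all locally absolutely continuous functions $u:(0,\infty)\to\mathbb{R}$ with $\lim_{r\to\infty}u(r)=0$, $u\in L^p_\theta$ and $u'\in L^p_\alpha$, and let $\|u\|=\big(\|u\|_{L^p_\theta}^p+\|u'\|_{L^p_\alpha}^p\big)^{1/p}$ for $u\in X$. Let $\mu_{\alpha,\theta}=(\theta+1)\,\omega_\alpha^{1/\alpha}$ and $$\varphi_p(t)=e^t-\sum_{k=0}^{k_0-1}\frac{t^k}{k!},\qquad k_0=\min\{j\in\mathbb{N}: j\ge p-1\}.$$ For $\sigma\ge 0$ and $\mu>0$ define, with values in $[0,\infty]$, $$TMC(\sigma,\alpha,\theta)=\sup_{u\in X,\ \|u\|\le 1}\int_0^\infty\varphi_p\big(\sigma|u|^{\frac{p}{p-1}}\big)\,\mathrm{d}\lambda_\theta,$$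 $$TMSC(\mu,\alpha,\theta)=\sup_{u\in X\setminus\{0\},\ \|u'\|_{L^p_\alpha}\le 1}\frac{1}{\|u\|^p_{L^p_\theta}}\int_0^\infty\varphi_p\big(\mu|u|^{\frac{p}{p-1}}\big)\,\mathrm{d}\lambda_\theta.$$ Then: 1. $TMC(\sigma,\alpha,\theta)<\infty$ for every $0\le\sigma\le\mu_{\alpha,\theta}$. 2. The constant $\mu_{\alpha,\theta}$ is sharp: $TMC(\sigma,\alpha,\theta)=\infty$ for every $\sigma>\mu_{\alpha,\theta}$. 3. For every $0\le\sigma\le\mu_{\alpha,\theta}$, $$TMC(\sigma,\alpha,\theta)=\sup_{\mu\in(0,\sigma)}\left(\frac{1-\left(\frac{\mu}{\sigma}\right)^{p-1}}{\left(\frac{\mu}{\sigma}\right)^{p-1}}\right)TMSC(\mu,\alpha,\theta),$$ where for $\sigma=0$ the supremum over the empty set is $0$. -/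

import Mathlib

open MeasureTheory Set Filter Topology
open scoped ENNReal

namespace TrudingerMoser

noncomputable section

/-- The "area of the unit sphere in dimension `θ + 1`":
`ω_θ = 2 π^((θ+1)/2) / Γ((θ+1)/2)`. -/
def omega (θ : ℝ) : ℝ :=
  2 * Real.pi ^ ((θ + 1) / 2) / Real.Gamma ((θ + 1) / 2)

/-- The measure `dλ_θ = ω_θ r^θ dr` on the half-line `(0, ∞)`, as a measure on `ℝ` which does not
charge `(-∞, 0]`. -/
def lam (θ : ℝ) : Measure ℝ :=
  (volume.restrict (Ioi 0)).withDensity fun r => ENNReal.ofReal (omega θ * r ^ θ)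

/-- The constant `μ_{α,θ} = (θ + 1) ω_α^(1/α)`. -/
def muCrit (α θ : ℝ) : ℝ :=
  (θ + 1) * omega α ^ (1 / α)

/-- `φ_p(t) = e^t - ∑_{k < k₀} t^k / k!`, where `k₀ = ⌈p - 1⌉₊` is the least natural number
which is at least `p - 1`. -/
def phi (p t : ℝ) : ℝ :=
  Real.exp t - ∑ k ∈ Finset.range ⌈p - 1⌉₊, t ^ k / (Nat.factorial k : ℝ)

/-- The norm of `L^q_θ`, `1 ≤ q < ∞`, with values in `[0, ∞]`. -/
def lpNorm (q θ : ℝ) (u : ℝ → ℝ) : ℝ≥0∞ :=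
  eLpNorm u (ENNReal.ofReal q) (lam θ)

/-- The weighted Sobolev space `X^{1,p}_∞(α, θ)`: functions which are locally absolutely continuous
on `(0, ∞)` and tend to `0` at infinity, with `u ∈ L^p_θ` and `u' ∈ L^p_α`. The functions are
written as functions on `ℝ`, but their values on `(-∞, 0]` play no role. -/
def sobolevX (p α θ : ℝ) : Set (ℝ → ℝ) :=
  {u | (∀ a b : ℝ, 0 < a → a ≤ b → AbsolutelyContinuousOnInterval u a b) ∧
    Tendsto u atTop (𝓝 0) ∧
    MemLp u (ENNReal.ofReal p) (lam θ) ∧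
    MemLp (deriv u) (ENNReal.ofReal p) (lam α)}

/-- The full norm `‖u‖ = (‖u‖_{L^p_θ}^p + ‖u'‖_{L^p_α}^p)^(1/p)`. -/
def fullNorm (p α θ : ℝ) (u : ℝ → ℝ) : ℝ≥0∞ :=
  (lpNorm p θ u ^ p + lpNorm p α (deriv u) ^ p) ^ (1 / p)

/-- The functional `∫_0^∞ φ_p(σ |u|^(p/(p-1))) dλ_θ`, with values in `[0, ∞]`. -/
def expFunctional (p θ σ : ℝ) (u : ℝ → ℝ) : ℝ≥0∞ :=
  ∫⁻ r, ENNReal.ofReal (phi p (σ * |u r| ^ (p / (p - 1)))) ∂(lam θ)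

/-- The subcritical supremum, over all nonzero `u` in the space with `‖u'‖_{L^p_α} ≤ 1`. -/
def TMSC (p α θ μ : ℝ) : ℝ≥0∞ :=
  ⨆ u ∈ {u | u ∈ sobolevX p α θ ∧ lpNorm p θ u ≠ 0 ∧ lpNorm p α (deriv u) ≤ 1},
    expFunctional p θ μ u / lpNorm p θ u ^ p

/-- The critical supremum, over all `u` in the space with `‖u‖ ≤ 1`. -/
def TMC (p α θ σ : ℝ) : ℝ≥0∞ :=
  ⨆ u ∈ {u | u ∈ sobolevX p α θ ∧ fullNorm p α θ u ≤ 1}, expFunctional p θ σ u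

end

end TrudingerMoser

/-!
Throughout `q = p / (p - 1)`, and `μ_c = muCrit (p - 1) θ` is the critical constant.

**Critical inequality.** Hölder's inequality for the weight `r ^ (p - 1)` gives, for `s ≤ r`,
`μ_c |u r - u s| ^ q ≤ E ^ (1 / (p - 1)) (θ + 1) log (r / s)`, where `E` is the gradient energy on
`(s, r]` (`abs_sub_rpow_le_energy`). Averaging `|u| ^ p` over intervals of length one then bounds
`u` on `[1, ∞)`, so that this region contributes at most a multiple of `‖u‖_{L^p_θ} ^ p`, because
`φ_p (σ |x| ^ q) = O(|x| ^ p)` for bounded `x`. It also provides a radius `R ∈ (1, 2]` with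
`ω_θ |u R| ^ p ≤ b := ‖u‖_{L^p_θ} ^ p`. On `(0, R]` convexity gives
`|u| ^ q ≤ (1 - b/2) ^ (1 - q) z ^ q + (b/2) ^ (1 - q) |u R| ^ q` for `z = (|u| - |u R|)₊`. The last
term is bounded by the choice of `R`, and since the gradient energy is at most `1 - b`, the first one
is the `q`-th power of a function of gradient energy at most one which vanishes at `R`
(`setLIntegral_exp_Ioc_le`). No monotonicity or rearrangement is needed.

In the variable `t = (θ + 1) log (R / r)` this leaves Moser's inequality
`∫_0^∞ exp (ψ ^ q - t) dt ≤ C(p)` (`MoserPair.lintegral_exp_le`). It holds because the set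
`{t - ψ (t) ^ q ≤ l}` has measure `O(l)`: if `ψ (s) ^ q ≥ s - l`, then only the energy `O(l / s)`
remains for `(s, ∞)`, too little for `ψ ^ q` to keep up with `t` beyond `s + O(l)`
(`MoserPair.sub_le`).

**The two suprema.** The gradient energy is invariant under dilations, whereas `‖u‖_{L^p_θ} ^ p` and
the functional scale by the same factor. Hence a competitor for the subcritical problem with parameter
`μ` can be multiplied by `(μ/σ) ^ (1/q)` and dilated until its full norm is at most one (`mul_TMSC_le_TMC`),
and a competitor for the critical problem can be divided by the norm of its derivative
(`TMC_le_iSup_TMSC`).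

**Sharpness.** For `μ > μ_c` Moser's truncated logarithms show that the subcritical supremum is
infinite (`TMSC_eq_top`), and with it every critical supremum with a larger parameter.
-/

namespace TrudingerMoser

/-! ### The measures `λ_θ` and the norms -/

lemma omega_pos {θ : ℝ} (hθ : -1 < θ) : 0 < omega θ := by
  have : 0 < Real.Gamma ((θ + 1) / 2) := Real.Gamma_pos_of_pos (by linarith)
  unfold omega
  positivity

lemma muCrit_pos {α θ : ℝ} (hα : -1 < α) (hθ : -1 < θ) : 0 < muCrit α θ :=
  mul_pos (by linarith) (Real.rpow_pos_of_pos (omega_pos hα) _)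

lemma setLIntegral_lam (θ : ℝ) {s : Set ℝ} (hs : MeasurableSet s) (f : ℝ → ℝ≥0∞) :
    ∫⁻ r in s, f r ∂(lam θ) =
      ∫⁻ r in s ∩ Ioi 0, ENNReal.ofReal (omega θ * r ^ θ) * f r := by
  have hm : Measurable fun r : ℝ => ENNReal.ofReal (omega θ * r ^ θ) := by fun_prop
  rw [lam, setLIntegral_withDensity_eq_setLIntegral_mul_non_measurable₀ _ hm.aemeasurable _ hs
    (ae_of_all _ fun _ => ENNReal.ofReal_lt_top), Measure.restrict_restrict hs]
  rfl

lemma lintegral_lam (θ : ℝ) (f : ℝ → ℝ≥0∞) :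
    ∫⁻ r, f r ∂(lam θ) = ∫⁻ r in Ioi 0, ENNReal.ofReal (omega θ * r ^ θ) * f r := by
  rw [← setLIntegral_univ, setLIntegral_lam θ MeasurableSet.univ, univ_inter]

lemma ae_lam_pos (θ : ℝ) : ∀ᵐ r ∂(lam θ), 0 < r := by
  have h : lam θ ≪ volume.restrict (Ioi 0) := withDensity_absolutelyContinuous _ _
  exact h.ae_le (ae_restrict_mem measurableSet_Ioi)

lemma lam_absolutelyContinuous (θ : ℝ) : lam θ ≪ volume :=
  (withDensity_absolutelyContinuous _ _).trans Measure.absolutelyContinuous_restrict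

/-- The dilation `r ↦ τ r` divides `λ_θ` by `τ ^ (θ + 1)`. -/
lemma lintegral_lam_comp_mul (θ : ℝ) {τ : ℝ} (hτ : 0 < τ) (f : ℝ → ℝ≥0∞) :
    ∫⁻ r, f (τ * r) ∂(lam θ) = ENNReal.ofReal (τ ^ (-(θ + 1))) * ∫⁻ r, f r ∂(lam θ) := by
  have himg : (fun r : ℝ => τ * r) '' Ioi 0 = Ioi 0 := by
    rw [image_mul_left_Ioi hτ, mul_zero]
  have hd : ∀ x ∈ Ioi (0 : ℝ), HasDerivWithinAt (fun r : ℝ => τ * r) τ (Ioi 0) x := fun x _ => by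
    simpa using (hasDerivWithinAt_id x (Ioi 0)).const_mul τ
  rw [lintegral_lam, lintegral_lam, ← lintegral_const_mul' _ _ ENNReal.ofReal_ne_top]
  conv_rhs => rw [← himg]
  rw [lintegral_image_eq_lintegral_abs_deriv_mul measurableSet_Ioi hd
    (fun a _ b _ h => mul_left_cancel₀ hτ.ne' h)]
  refine setLIntegral_congr_fun measurableSet_Ioi fun r hr => ?_
  have hr : 0 < r := hr
  rw [← mul_assoc, ← mul_assoc, ← ENNReal.ofReal_mul (abs_nonneg _),
    ← ENNReal.ofReal_mul (by positivity), abs_of_pos hτ, Real.mul_rpow hτ.le hr.le]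
  congr 2
  have : τ * τ ^ (-(θ + 1)) * τ ^ θ = 1 := by
    nth_rewrite 1 [← Real.rpow_one τ]
    rw [← Real.rpow_add hτ, ← Real.rpow_add hτ]
    simp
  linear_combination (-omega θ * r ^ θ) * this

lemma lpNorm_rpow {p : ℝ} (hp : 0 < p) (θ : ℝ) (u : ℝ → ℝ) :
    lpNorm p θ u ^ p = ∫⁻ r, ‖u r‖ₑ ^ p ∂(lam θ) := by
  rw [lpNorm, eLpNorm_eq_lintegral_rpow_enorm_toReal (by simpa using hp) (by simp),
    ENNReal.toReal_ofReal hp.le, ← ENNReal.rpow_mul, one_div_mul_cancel hp.ne', ENNReal.rpow_one]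

lemma lpNorm_const_mul {p : ℝ} (θ c : ℝ) (u : ℝ → ℝ) :
    lpNorm p θ (fun r => c * u r) = ‖c‖ₑ * lpNorm p θ u :=
  eLpNorm_const_smul c u _ _

lemma lpNorm_rpow_comp_mul {p : ℝ} (hp : 0 < p) (θ : ℝ) {τ : ℝ} (hτ : 0 < τ) (u : ℝ → ℝ) :
    lpNorm p θ (fun r => u (τ * r)) ^ p =
      ENNReal.ofReal (τ ^ (-(θ + 1))) * lpNorm p θ u ^ p := by
  rw [lpNorm_rpow hp, lpNorm_rpow hp, ← lintegral_lam_comp_mul θ hτ]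

lemma fullNorm_le_one_iff {p : ℝ} (hp : 0 < p) (α θ : ℝ) (u : ℝ → ℝ) :
    fullNorm p α θ u ≤ 1 ↔ lpNorm p θ u ^ p + lpNorm p α (deriv u) ^ p ≤ 1 := by
  rw [fullNorm, one_div, ENNReal.rpow_inv_le_iff hp, ENNReal.one_rpow]

/-! ### The truncated exponential -/

lemma hasSum_phi (p t : ℝ) :
    HasSum (fun k : ℕ => t ^ (k + ⌈p - 1⌉₊) / ((k + ⌈p - 1⌉₊).factorial : ℝ)) (phi p t) := by
  have h := NormedSpace.expSeries_div_hasSum_exp t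
  rw [← Real.exp_eq_exp_ℝ] at h
  exact (hasSum_nat_add_iff' ⌈p - 1⌉₊).2 h

lemma phi_nonneg (p : ℝ) {t : ℝ} (ht : 0 ≤ t) : 0 ≤ phi p t :=
  (hasSum_phi p t).nonneg fun _ => by positivity

lemma phi_mono (p : ℝ) {s t : ℝ} (hs : 0 ≤ s) (hst : s ≤ t) : phi p s ≤ phi p t :=
  hasSum_le (fun _ => by gcongr) (hasSum_phi p s) (hasSum_phi p t)

lemma phi_le_exp (p : ℝ) {t : ℝ} (ht : 0 ≤ t) : phi p t ≤ Real.exp t :=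
  sub_le_self _ (Finset.sum_nonneg fun _ _ => by positivity)

lemma phi_le_pow_mul_exp (p : ℝ) {t : ℝ} (ht : 0 ≤ t) :
    phi p t ≤ t ^ ⌈p - 1⌉₊ * Real.exp t := by
  have h := NormedSpace.expSeries_div_hasSum_exp t
  rw [← Real.exp_eq_exp_ℝ] at h
  refine hasSum_le (fun k => ?_) (hasSum_phi p t) (h.mul_left _)
  rw [← mul_div_assoc, ← pow_add, add_comm]
  gcongr
  lia

lemma phi_zero {p : ℝ} (hp : 1 < p) : phi p 0 = 0 := by
  refine le_antisymm ((phi_le_pow_mul_exp p le_rfl).trans ?_) (phi_nonneg p le_rfl)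
  rw [zero_pow (Nat.ceil_pos.2 (by linarith)).ne', zero_mul]

/-- On bounded sets `φ_p (σ |x| ^ (p / (p - 1)))` is dominated by `|x| ^ p`: the truncation starts
at an exponent `k₀` with `k₀ p / (p - 1) ≥ p`. -/
lemma phi_le_mul_rpow {p σ M x : ℝ} (hp : 1 < p) (hσ : 0 ≤ σ) (hx : 0 ≤ x) (hM : x ≤ M) :
    phi p (σ * x ^ (p / (p - 1))) ≤
      σ ^ ⌈p - 1⌉₊ * M ^ (p / (p - 1) * ⌈p - 1⌉₊ - p) * Real.exp (σ * M ^ (p / (p - 1))) *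
        x ^ p := by
  have hp1 : 0 < p - 1 := by linarith
  rcases hx.eq_or_lt with rfl | hx0
  · rw [Real.zero_rpow (div_pos (by linarith) hp1).ne', mul_zero, phi_zero hp,
      Real.zero_rpow (by linarith), mul_zero]
  have hk : 0 ≤ p / (p - 1) * ⌈p - 1⌉₊ - p := by
    have : p / (p - 1) * (p - 1) ≤ p / (p - 1) * ⌈p - 1⌉₊ := by
      gcongr
      exact Nat.le_ceil _
    rw [div_mul_cancel₀ _ hp1.ne'] at this
    linarith
  refine (phi_le_pow_mul_exp p (by positivity)).trans ?_
  have hx2 : (x ^ (p / (p - 1))) ^ ⌈p - 1⌉₊ = x ^ (p / (p - 1) * ⌈p - 1⌉₊ - p) * x ^ p := by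
    rw [← Real.rpow_natCast, ← Real.rpow_mul hx, ← Real.rpow_add hx0, sub_add_cancel]
  have h1 : x ^ (p / (p - 1) * ⌈p - 1⌉₊ - p) ≤ M ^ (p / (p - 1) * ⌈p - 1⌉₊ - p) := by gcongr
  have h2 : Real.exp (σ * x ^ (p / (p - 1))) ≤ Real.exp (σ * M ^ (p / (p - 1))) := by
    gcongr
  have hM0 : 0 ≤ M := hx.trans hM
  rw [mul_pow, hx2]
  calc σ ^ ⌈p - 1⌉₊ * (x ^ (p / (p - 1) * ⌈p - 1⌉₊ - p) * x ^ p) *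
        Real.exp (σ * x ^ (p / (p - 1)))
      ≤ σ ^ ⌈p - 1⌉₊ * (M ^ (p / (p - 1) * ⌈p - 1⌉₊ - p) * x ^ p) *
        Real.exp (σ * M ^ (p / (p - 1))) := by gcongr
    _ = _ := by ring

lemma tendsto_phi_mul_exp_neg (p : ℝ) :
    Tendsto (fun t => phi p t * Real.exp (-t)) atTop (𝓝 1) := by
  have h : Tendsto (fun t : ℝ => 1 - ∑ k ∈ Finset.range ⌈p - 1⌉₊,
      t ^ k * Real.exp (-t) / (k.factorial : ℝ)) atTop (𝓝 (1 - ∑ k ∈ Finset.range ⌈p - 1⌉₊,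
      0 / (k.factorial : ℝ))) :=
    tendsto_const_nhds.sub (tendsto_finsetSum _ fun k _ =>
      (Real.tendsto_pow_mul_exp_neg_atTop_nhds_zero k).div_const _)
  simp only [zero_div, Finset.sum_const_zero, sub_zero] at h
  refine h.congr fun t => ?_
  rw [phi, sub_mul, ← Real.exp_add, add_neg_cancel, Real.exp_zero, Finset.sum_mul]
  simp only [div_mul_eq_mul_div]

lemma expFunctional_mono {p θ σ τ : ℝ} (hσ : 0 ≤ σ) (h : σ ≤ τ) (u : ℝ → ℝ) :
    expFunctional p θ σ u ≤ expFunctional p θ τ u :=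
  lintegral_mono fun r => ENNReal.ofReal_le_ofReal (phi_mono p (by positivity) (by gcongr))

/-- A function with vanishing `L^p_θ` norm contributes nothing to the functional. -/
lemma expFunctional_eq_zero {p θ : ℝ} (hp : 1 < p) (σ : ℝ) {u : ℝ → ℝ}
    (hu : AEStronglyMeasurable u (lam θ)) (h : lpNorm p θ u = 0) :
    expFunctional p θ σ u = 0 := by
  have h0 : u =ᵐ[lam θ] 0 := (eLpNorm_eq_zero_iff hu (by simpa using by linarith)).1 h
  rw [expFunctional, lintegral_congr_ae (g := fun _ => 0), lintegral_zero]
  filter_upwards [h0] with r hr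
  have : p / (p - 1) ≠ 0 := (div_pos (by linarith) (by linarith)).ne'
  simp [hr, Real.zero_rpow this, phi_zero hp]

/-! ### Oscillation of a function with finite gradient energy -/

/-- The gradient energy `∫_a^b |u'|^p dλ_{p-1}`. -/
noncomputable def energy (p : ℝ) (u : ℝ → ℝ) (a b : ℝ) : ℝ≥0∞ :=
  ∫⁻ r in Ioc a b, ‖deriv u r‖ₑ ^ p ∂(lam (p - 1))

lemma energy_le {p : ℝ} (hp : 0 < p) (u : ℝ → ℝ) (a b : ℝ) :
    energy p u a b ≤ lpNorm p (p - 1) (deriv u) ^ p := by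
  rw [lpNorm_rpow hp]
  exact setLIntegral_le_lintegral _ _

lemma energy_add (p : ℝ) (u : ℝ → ℝ) {a b c : ℝ} (hab : a ≤ b) (hbc : b ≤ c) :
    energy p u a c = energy p u a b + energy p u b c := by
  rw [energy, ← Ioc_union_Ioc_eq_Ioc hab hbc,
    lintegral_union measurableSet_Ioc (Ioc_disjoint_Ioc_of_le le_rfl)]
  rfl

lemma setLIntegral_const_mul_inv {a b c : ℝ} (ha : 0 < a) (hab : a ≤ b) (hc : 0 ≤ c) :
    ∫⁻ r in Ioc a b, ENNReal.ofReal (c * r⁻¹) = ENNReal.ofReal (c * Real.log (b / a)) := by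
  have hi : IntervalIntegrable (fun r : ℝ => c * r⁻¹) volume a b := by
    refine (intervalIntegrable_inv_iff.2 (Or.inr ?_)).const_mul c
    rw [uIcc_of_le hab]
    exact fun h => absurd h.1 (not_le.2 ha)
  rw [← integral_inv_of_pos ha (ha.trans_le hab), ← intervalIntegral.integral_const_mul,
    intervalIntegral.integral_of_le hab, ofReal_integral_eq_lintegral_ofReal]
  · exact (intervalIntegrable_iff_integrableOn_Ioc_of_le hab).1 hi
  · filter_upwards [ae_restrict_mem measurableSet_Ioc] with r hr
    have : 0 < r := ha.trans hr.1
    positivity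

/-- Hölder's inequality for the weight `r ^ (p - 1)`, whose dual weight is `1 / r`. -/
lemma enorm_sub_le_energy {p a b : ℝ} (hp : 1 < p) {u : ℝ → ℝ} (ha : 0 < a) (hab : a ≤ b)
    (hu : AbsolutelyContinuousOnInterval u a b) :
    ‖u b - u a‖ₑ ≤ energy p u a b ^ (1 / p) *
      ENNReal.ofReal (omega (p - 1) ^ (-(1 / (p - 1))) * Real.log (b / a)) ^ (1 / (p / (p - 1))) := by
  have hp0 : 0 < p := by linarith
  have hp1 : 0 < p - 1 := by linarith
  have hω : 0 < omega (p - 1) := omega_pos (by linarith)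
  have hpq : p.HolderConjugate (p / (p - 1)) := Real.HolderConjugate.conjExponent hp
  have hm : AEMeasurable (fun r => ENNReal.ofReal ((omega (p - 1) * r ^ (p - 1)) ^ (1 / p)) *
      ‖deriv u r‖ₑ) (volume.restrict (Ioc a b)) := by
    have := measurable_deriv u
    fun_prop
  have hm' : AEMeasurable (fun r => ENNReal.ofReal ((omega (p - 1) * r ^ (p - 1)) ^ (-(1 / p))))
      (volume.restrict (Ioc a b)) := by fun_prop
  have hI : Ioc a b ∩ Ioi 0 = Ioc a b := inter_eq_left.2 fun r hr => ha.trans hr.1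
  rw [← hu.integral_deriv_eq_sub, intervalIntegral.integral_of_le hab]
  refine (enorm_integral_le_lintegral_enorm _).trans ?_
  have key := ENNReal.lintegral_mul_le_Lp_mul_Lq (volume.restrict (Ioc a b)) hpq hm hm'
  refine le_trans (le_of_eq ?_) (key.trans (le_of_eq ?_))
  · refine setLIntegral_congr_fun measurableSet_Ioc fun r hr => ?_
    have hr : 0 < r := ha.trans hr.1
    have hw : 0 < omega (p - 1) * r ^ (p - 1) := by positivity
    simp only [Pi.mul_apply]
    rw [mul_right_comm, ← ENNReal.ofReal_mul (by positivity), ← Real.rpow_add hw, add_neg_cancel,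
      Real.rpow_zero, ENNReal.ofReal_one, one_mul]
  · congr 2
    · rw [energy, setLIntegral_lam _ measurableSet_Ioc, hI]
      refine setLIntegral_congr_fun measurableSet_Ioc fun r hr => ?_
      have hr : 0 < r := ha.trans hr.1
      rw [ENNReal.mul_rpow_of_nonneg _ _ hp0.le, ENNReal.ofReal_rpow_of_nonneg (by positivity) hp0.le,
        ← Real.rpow_mul (by positivity), one_div_mul_cancel hp0.ne', Real.rpow_one]
    · rw [← setLIntegral_const_mul_inv ha hab (by positivity)]
      refine setLIntegral_congr_fun measurableSet_Ioc fun r hr => ?_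
      have hr : 0 < r := ha.trans hr.1
      rw [ENNReal.ofReal_rpow_of_nonneg (by positivity) (by positivity),
        ← Real.rpow_mul (by positivity), Real.mul_rpow hω.le (by positivity),
        ← Real.rpow_mul hr.le]
      have e1 : -(1 / p) * (p / (p - 1)) = -(1 / (p - 1)) := by field_simp
      have e2 : (p - 1) * -(1 / (p - 1)) = -1 := by field_simp
      rw [e1, e2, Real.rpow_neg_one]

/-- The form of `enorm_sub_le_energy` in which the critical constant appears. -/
lemma abs_sub_rpow_le_energy {p θ a b : ℝ} (hp : 1 < p) (hθ : -1 < θ) {u : ℝ → ℝ} (ha : 0 < a)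
    (hab : a ≤ b) (hu : AbsolutelyContinuousOnInterval u a b) (hE : energy p u a b ≠ ∞) :
    muCrit (p - 1) θ ^ (1 / (p / (p - 1))) * |u b - u a| ≤
      (energy p u a b).toReal ^ (1 / p) *
        ((θ + 1) * Real.log (b / a)) ^ (1 / (p / (p - 1))) := by
  have hp1 : 0 < p - 1 := by linarith
  have hω : 0 < omega (p - 1) := omega_pos (by linarith)
  have hl : 0 ≤ Real.log (b / a) := Real.log_nonneg ((one_le_div ha).2 hab)
  have h := ENNReal.toReal_mono
    (ENNReal.mul_ne_top (ENNReal.rpow_ne_top_of_nonneg (by positivity) hE)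
      (ENNReal.rpow_ne_top_of_nonneg (by positivity) ENNReal.ofReal_ne_top))
    (enorm_sub_le_energy hp ha hab hu)
  rw [ENNReal.toReal_mul, ← ENNReal.toReal_rpow, ← ENNReal.toReal_rpow,
    ENNReal.toReal_ofReal (by positivity), toReal_enorm, Real.norm_eq_abs] at h
  have hμ : 0 ≤ muCrit (p - 1) θ := (muCrit_pos (by linarith) hθ).le
  calc muCrit (p - 1) θ ^ (1 / (p / (p - 1))) * |u b - u a|
      ≤ muCrit (p - 1) θ ^ (1 / (p / (p - 1))) * ((energy p u a b).toReal ^ (1 / p) *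
        (omega (p - 1) ^ (-(1 / (p - 1))) * Real.log (b / a)) ^ (1 / (p / (p - 1)))) := by gcongr
    _ = (energy p u a b).toReal ^ (1 / p) * (muCrit (p - 1) θ *
        (omega (p - 1) ^ (-(1 / (p - 1))) * Real.log (b / a))) ^ (1 / (p / (p - 1))) := by
      rw [Real.mul_rpow hμ (by positivity)]
      ring
    _ = _ := by
      congr 2
      rw [muCrit, Real.rpow_neg hω.le]
      field_simp

lemma continuousOn_of_mem_sobolevX {p α θ : ℝ} {u : ℝ → ℝ} (hu : u ∈ sobolevX p α θ) :
    ContinuousOn u (Ioi 0) := by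
  intro r hr
  have hr : 0 < r := hr
  have h := (hu.1 (r / 2) (r + 1) (by linarith) (by linarith)).continuousOn
  rw [uIcc_of_le (by linarith)] at h
  exact (h.continuousAt (Icc_mem_nhds (by linarith) (by linarith))).continuousWithinAt

/-- A function of the space without gradient energy is constant, hence zero. -/
lemma eq_zero_of_lpNorm_deriv_eq_zero {p θ : ℝ} (hp : 1 < p) {u : ℝ → ℝ}
    (hu : u ∈ sobolevX p (p - 1) θ) (h : lpNorm p (p - 1) (deriv u) = 0) {r : ℝ} (hr : 0 < r) :
    u r = 0 := by
  have hc : ∀ s, r ≤ s → u s = u r := fun s hs => by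
    have hE : energy p u r s = 0 := by
      have := energy_le (by linarith : 0 < p) u r s
      rwa [h, ENNReal.zero_rpow_of_pos (by linarith), nonpos_iff_eq_zero] at this
    have h1 := enorm_sub_le_energy hp hr hs (hu.1 r s hr hs)
    rw [hE, ENNReal.zero_rpow_of_pos (by positivity), zero_mul, nonpos_iff_eq_zero, enorm_eq_zero,
      sub_eq_zero] at h1
    exact h1
  have h2 : Tendsto u atTop (𝓝 (u r)) :=
    tendsto_const_nhds.congr' ((eventually_ge_atTop r).mono fun s hs => (hc s hs).symm)
  exact tendsto_nhds_unique h2 hu.2.1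

/-! ### Moser's one-dimensional inequality -/

/-- Convexity of `x ↦ x ^ q`, in the form used to separate a main term from a perturbation. -/
lemma add_rpow_le_split {q x y η : ℝ} (hq : 1 ≤ q) (hx : 0 ≤ x) (hy : 0 ≤ y) (h0 : 0 < η)
    (h1 : η < 1) : (x + y) ^ q ≤ (1 - η) ^ (1 - q) * x ^ q + η ^ (1 - q) * y ^ q := by
  have h1' : 0 < 1 - η := by linarith
  have h := (convexOn_rpow hq).2 (show x / (1 - η) ∈ Ici 0 from div_nonneg hx h1'.le)
    (show y / η ∈ Ici 0 from div_nonneg hy h0.le) h1'.le h0.le (by ring)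
  simp only [smul_eq_mul] at h
  rw [mul_div_cancel₀ _ h1'.ne', mul_div_cancel₀ _ h0.ne', Real.div_rpow hx h1'.le,
    Real.div_rpow hy h0.le] at h
  rw [Real.rpow_sub h1', Real.rpow_sub h0, Real.rpow_one, Real.rpow_one]
  calc _ ≤ _ := h
    _ = _ := by ring

/-- The hypotheses of Moser's inequality. For `ψ` nondecreasing with derivative of `L^p` norm at
most one they hold with `G t = ∫_0^t |ψ'|^p`, by Hölder's inequality. -/
structure MoserPair (p : ℝ) (ψ G : ℝ → ℝ) : Prop where
  zero : ψ 0 = 0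
  nonneg : ∀ t, 0 ≤ t → 0 ≤ ψ t
  energy_zero : 0 ≤ G 0
  energy_le_one : ∀ t, 0 ≤ t → G t ≤ 1
  energy_mono : ∀ s t, 0 ≤ s → s ≤ t → G s ≤ G t
  le_add : ∀ s t, 0 ≤ s → s ≤ t →
    ψ t ≤ ψ s + (t - s) ^ (1 / (p / (p - 1))) * (G t - G s) ^ (1 / p)

namespace MoserPair

variable {p : ℝ} {ψ G : ℝ → ℝ}

lemma rpow_le (h : MoserPair p ψ G) (hp : 1 < p) {t : ℝ} (ht : 0 ≤ t) :
    ψ t ^ (p / (p - 1)) ≤ t * G t ^ (1 / (p - 1)) := by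
  have hp0 : 0 < p := by linarith
  have hp1 : 0 < p - 1 := by linarith
  have hG0 : 0 ≤ G t := h.energy_zero.trans (h.energy_mono 0 t le_rfl ht)
  have h1 : ψ t ≤ t ^ (1 / (p / (p - 1))) * G t ^ (1 / p) := by
    have := h.le_add 0 t le_rfl ht
    rw [h.zero, zero_add, sub_zero] at this
    refine this.trans ?_
    have := h.energy_zero
    have := h.energy_mono 0 t le_rfl ht
    gcongr
    linarith
  calc ψ t ^ (p / (p - 1)) ≤ (t ^ (1 / (p / (p - 1))) * G t ^ (1 / p)) ^ (p / (p - 1)) := by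
        have := h.nonneg t ht
        gcongr
    _ = t * G t ^ (1 / (p - 1)) := by
      rw [Real.mul_rpow (by positivity) (by positivity), ← Real.rpow_mul ht, ← Real.rpow_mul hG0,
        one_div_mul_cancel (by positivity), Real.rpow_one]
      congr 2
      field_simp

/-- If `ψ (s) ^ q` nearly attains its maximal value `s`, the energy beyond `s` is small. -/
lemma one_sub_le (h : MoserPair p ψ G) (hp : 2 ≤ p) {s l : ℝ} (hs : 0 < s)
    (hls : l ≤ s) (hF : s - ψ s ^ (p / (p - 1)) ≤ l) : 1 - G s ≤ (p - 1) * l / s := by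
  have hp1 : 0 < p - 1 := by linarith
  have hG0 : 0 ≤ G s := h.energy_zero.trans (h.energy_mono 0 s le_rfl hs.le)
  have h1 : s - l ≤ s * G s ^ (1 / (p - 1)) := by
    linarith [h.rpow_le (by linarith) hs.le]
  have hls' : l / s ≤ 1 := (div_le_one hs).2 hls
  have h2 : 1 - l / s ≤ G s ^ (1 / (p - 1)) := by
    rw [show 1 - l / s = (s - l) / s by field_simp, div_le_iff₀ hs]
    linarith
  have h3 : (1 - l / s) ^ (p - 1) ≤ G s := by
    calc (1 - l / s) ^ (p - 1) ≤ (G s ^ (1 / (p - 1))) ^ (p - 1) := by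
          gcongr
      _ = G s := by
        rw [← Real.rpow_mul hG0, one_div_mul_cancel hp1.ne', Real.rpow_one]
  have h4 := one_add_mul_self_le_rpow_one_add (s := -(l / s)) (by linarith) (p := p - 1)
    (by linarith)
  rw [← sub_eq_add_neg] at h4
  have h5 : (p - 1) * l / s = (p - 1) * (l / s) := by ring
  rw [h5]
  linarith

/-- The sublevel set `{t - ψ (t) ^ q ≤ l}` has, far from the origin, diameter `O(l)`. -/
lemma sub_le (h : MoserPair p ψ G) (hp : 2 ≤ p) {s t l : ℝ} (hl : 0 < l) (hst : s ≤ t)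
    (hs : 2 * (2 ^ (p - 1) * (p - 1)) * l ≤ s)
    (hFs : s - ψ s ^ (p / (p - 1)) ≤ l) (hFt : t - ψ t ^ (p / (p - 1)) ≤ l) :
    t - s ≤ 2 * (1 + 2 * (2 ^ (p - 1) * (p - 1))) * l := by
  have hp0 : 0 < p := by linarith
  have hp1 : 0 < p - 1 := by linarith
  have hK : 1 ≤ (2 : ℝ) ^ (p - 1) := Real.one_le_rpow (by norm_num) hp1.le
  set K : ℝ := 2 ^ (p - 1) with hKdef
  have hKp : 1 ≤ K * (p - 1) := one_le_mul_of_one_le_of_one_le hK (by linarith)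
  have hls : 2 * l ≤ s := le_trans (by nlinarith) hs
  have hs0 : 0 < s := by linarith
  have hL := h.one_sub_le hp hs0 (by linarith) hFs
  have hLt : G t - G s ≤ (p - 1) * l / s := by
    linarith [h.energy_le_one t (hs0.le.trans hst)]
  have hL0 : 0 ≤ G t - G s := by linarith [h.energy_mono s t hs0.le hst]
  -- The weight is chosen so that the contribution of `(s, t)` is at most half of its length.
  set η : ℝ := K * (p - 1) * l / s with hη
  have hη0 : 0 < η := by positivity
  have hη1 : η ≤ 1 / 2 := by
    rw [hη, div_le_iff₀ hs0]
    linarith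
  have hq : p / (p - 1) - 1 = 1 / (p - 1) := by
    field_simp
    ring
  have hq1 : 1 ≤ p / (p - 1) := by
    have : 0 < 1 / (p - 1) := by positivity
    linarith
  have hψs := h.nonneg s hs0.le
  have h1 : ψ t ^ (p / (p - 1)) ≤ (1 - η) ^ (1 - p / (p - 1)) * ψ s ^ (p / (p - 1)) +
      η ^ (1 - p / (p - 1)) *
        ((t - s) ^ (1 / (p / (p - 1))) * (G t - G s) ^ (1 / p)) ^ (p / (p - 1)) := by
    refine le_trans ?_ (add_rpow_le_split hq1 hψs ?_ hη0 (by linarith))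
    · have := h.nonneg t (hs0.le.trans hst)
      have := h.le_add s t hs0.le hst
      gcongr
    · exact mul_nonneg (Real.rpow_nonneg (by linarith) _) (Real.rpow_nonneg hL0 _)
  have h2 : ψ s ^ (p / (p - 1)) ≤ s := by
    refine (h.rpow_le (by linarith) hs0.le).trans (mul_le_of_le_one_right hs0.le ?_)
    exact Real.rpow_le_one (h.energy_zero.trans (h.energy_mono 0 s le_rfl hs0.le))
      (h.energy_le_one s hs0.le) (by positivity)
  have h3 : (1 - η) ^ (1 - p / (p - 1)) ≤ 1 + 2 * η := by
    have h1η : 0 < 1 - η := by linarith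
    calc (1 - η) ^ (1 - p / (p - 1)) ≤ (1 - η) ^ (-1 : ℝ) := by
          refine Real.rpow_le_rpow_of_exponent_ge h1η (by linarith) ?_
          have : 1 / (p - 1) ≤ 1 := by
            rw [div_le_one hp1]
            linarith
          linarith
      _ ≤ 1 + 2 * η := by
        rw [Real.rpow_neg_one, inv_le_iff_one_le_mul₀ h1η]
        nlinarith
  have h4 : η ^ (1 - p / (p - 1)) *
      ((t - s) ^ (1 / (p / (p - 1))) * (G t - G s) ^ (1 / p)) ^ (p / (p - 1)) ≤
        (t - s) / 2 := by
    have hts : 0 ≤ t - s := by linarith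
    rw [Real.mul_rpow (by positivity) (by positivity), ← Real.rpow_mul hts, ← Real.rpow_mul hL0,
      one_div_mul_cancel (by positivity), Real.rpow_one,
      show 1 / p * (p / (p - 1)) = 1 / (p - 1) by field_simp,
      show 1 - p / (p - 1) = -(1 / (p - 1)) by linarith, Real.rpow_neg hη0.le]
    have h5 : (G t - G s) / η ≤ (2 ^ (p - 1))⁻¹ := by
      rw [div_le_iff₀ hη0]
      refine hLt.trans (le_of_eq ?_)
      rw [hη, hKdef]
      field_simp
    have h6 : ((G t - G s) / η) ^ (1 / (p - 1)) ≤ 2⁻¹ := by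
      calc ((G t - G s) / η) ^ (1 / (p - 1)) ≤ ((2 ^ (p - 1))⁻¹) ^ (1 / (p - 1)) := by gcongr
        _ = 2⁻¹ := by
          rw [Real.inv_rpow (by positivity), ← Real.rpow_mul (by norm_num),
            mul_one_div_cancel hp1.ne', Real.rpow_one]
    rw [Real.div_rpow hL0 hη0.le] at h6
    calc (η ^ (1 / (p - 1)))⁻¹ * ((t - s) * (G t - G s) ^ (1 / (p - 1)))
        = (t - s) * ((G t - G s) ^ (1 / (p - 1)) / η ^ (1 / (p - 1))) := by ring
      _ ≤ (t - s) * 2⁻¹ := by gcongr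
      _ = (t - s) / 2 := by ring
  have h5 : (1 - η) ^ (1 - p / (p - 1)) * ψ s ^ (p / (p - 1)) ≤ (1 + 2 * η) * s := by gcongr
  have h6 : (1 + 2 * η) * s = s + 2 * (K * (p - 1) * l) := by
    rw [hη]
    field_simp
  nlinarith

/-- The sublevel set `{t ≥ 0 | t - ψ (t) ^ q ≤ l}` lies in two intervals of length `O(l)`. -/
lemma exists_subset (h : MoserPair p ψ G) (hp : 2 ≤ p) {l : ℝ} (hl : 0 < l) :
    ∃ c : ℝ, ∀ t, 0 ≤ t → t - ψ t ^ (p / (p - 1)) ≤ l →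
      t ∈ Icc 0 (2 * (2 ^ (p - 1) * (p - 1)) * l) ∪
        Icc (c - 2 * (1 + 2 * (2 ^ (p - 1) * (p - 1))) * l)
          (c + 2 * (1 + 2 * (2 ^ (p - 1) * (p - 1))) * l) := by
  by_cases hc : ∃ c, 2 * (2 ^ (p - 1) * (p - 1)) * l ≤ c ∧ c - ψ c ^ (p / (p - 1)) ≤ l
  · obtain ⟨c, hc1, hc2⟩ := hc
    refine ⟨c, fun t ht hFt => ?_⟩
    rcases le_total t (2 * (2 ^ (p - 1) * (p - 1)) * l) with h1 | h1
    · exact Or.inl ⟨ht, h1⟩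
    · right
      rcases le_total c t with hct | htc
      · have := h.sub_le hp hl hct hc1 hc2 hFt
        constructor <;> linarith
      · have := h.sub_le hp hl htc h1 hFt hc2
        constructor <;> linarith
  · push Not at hc
    refine ⟨0, fun t ht hFt => Or.inl ⟨ht, ?_⟩⟩
    by_contra! h1
    exact absurd (hc t h1.le) (not_lt.2 hFt)

/-- **Moser's inequality**: the constant is uniform over all pairs. -/
theorem lintegral_exp_le (h : MoserPair p ψ G) (hp : 2 ≤ p) :
    ∫⁻ t in Ioi 0, ENNReal.ofReal (Real.exp (ψ t ^ (p / (p - 1)) - t)) ≤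
      ∑' n : ℕ, ENNReal.ofReal (Real.exp (-n) * (n + 1) *
        (4 + 10 * (2 ^ (p - 1) * (p - 1)))) := by
  have hp1 : 0 < p - 1 := by linarith
  have hK : 0 < (2 : ℝ) ^ (p - 1) * (p - 1) := by positivity
  set K : ℝ := 2 ^ (p - 1) * (p - 1) with hKdef
  choose c hc using fun n : ℕ => h.exists_subset hp (l := n + 1) (by positivity)
  rw [← hKdef] at hc
  set A : ℕ → Set ℝ := fun n => Icc 0 (2 * K * (n + 1)) ∪
    Icc (c n - 2 * (1 + 2 * K) * (n + 1)) (c n + 2 * (1 + 2 * K) * (n + 1)) with hA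
  have hAm : ∀ n, MeasurableSet (A n) := fun n => measurableSet_Icc.union measurableSet_Icc
  have hpt : ∀ t ∈ Ioi (0 : ℝ), ENNReal.ofReal (Real.exp (ψ t ^ (p / (p - 1)) - t)) ≤
      ∑' n : ℕ, (A n).indicator (fun _ => ENNReal.ofReal (Real.exp (-n))) t := by
    intro t ht
    have ht : 0 < t := ht
    have hF : 0 ≤ t - ψ t ^ (p / (p - 1)) := by
      have h1 := h.rpow_le (by linarith) ht.le
      have h2 : t * G t ^ (1 / (p - 1)) ≤ t := mul_le_of_le_one_right ht.le
        (Real.rpow_le_one (h.energy_zero.trans (h.energy_mono 0 t le_rfl ht.le))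
          (h.energy_le_one t ht.le) (by positivity))
      linarith
    set n := ⌊t - ψ t ^ (p / (p - 1))⌋₊ with hn
    have hmem : t ∈ A n := hc n t ht.le (Nat.lt_floor_add_one _).le
    refine le_trans ?_ (ENNReal.le_tsum n)
    rw [indicator_of_mem hmem]
    refine ENNReal.ofReal_le_ofReal (Real.exp_le_exp.2 ?_)
    linarith [Nat.floor_le hF]
  have hvol : ∀ n, volume (A n) ≤ ENNReal.ofReal ((n + 1) * (4 + 10 * K)) := by
    intro n
    refine (measure_union_le _ _).trans ?_
    rw [Real.volume_Icc, Real.volume_Icc, ← ENNReal.ofReal_add (by ring_nf; positivity)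
      (by ring_nf; positivity)]
    refine ENNReal.ofReal_le_ofReal (le_of_eq (by ring))
  calc ∫⁻ t in Ioi 0, ENNReal.ofReal (Real.exp (ψ t ^ (p / (p - 1)) - t))
      ≤ ∫⁻ t in Ioi 0, ∑' n : ℕ, (A n).indicator (fun _ => ENNReal.ofReal (Real.exp (-n))) t :=
        setLIntegral_mono' measurableSet_Ioi hpt
    _ ≤ ∫⁻ t, ∑' n : ℕ, (A n).indicator (fun _ => ENNReal.ofReal (Real.exp (-n))) t :=
        setLIntegral_le_lintegral _ _
    _ = ∑' n : ℕ, ENNReal.ofReal (Real.exp (-n)) * volume (A n) := by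
      rw [lintegral_tsum fun n => (measurable_const.indicator (hAm n)).aemeasurable]
      simp only [lintegral_indicator_const (hAm _)]
    _ ≤ _ := by
      refine ENNReal.tsum_le_tsum fun n => ?_
      rw [mul_assoc (Real.exp _), ENNReal.ofReal_mul (Real.exp_nonneg _)]
      gcongr
      exact hvol n

end MoserPair

lemma tsum_moser_lt_top {p : ℝ} (hp : 1 ≤ p) :
    ∑' n : ℕ, ENNReal.ofReal (Real.exp (-n) * (n + 1) *
      (4 + 10 * (2 ^ (p - 1) * (p - 1)))) < ∞ := by
  have hp1 : 0 ≤ p - 1 := by linarith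
  have h1 := Real.summable_pow_mul_exp_neg_nat_mul 1 one_pos
  have h0 := Real.summable_pow_mul_exp_neg_nat_mul 0 one_pos
  have hs : Summable fun n : ℕ => Real.exp (-n) * ((n : ℝ) + 1) *
      (4 + 10 * (2 ^ (p - 1) * (p - 1))) :=
    ((h1.add h0).congr fun n => by simp; ring).mul_right _
  rw [← ENNReal.ofReal_tsum_of_nonneg (fun n => by positivity) hs]
  exact ENNReal.ofReal_lt_top

/-! ### Finiteness of the critical supremum -/

/-- The substitution `r = R e^{-t/(θ+1)}`, which turns `λ_θ` on `(0, R]` into a multiple of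
`e^{-t} dt`. -/
lemma setLIntegral_lam_Ioc {θ R : ℝ} (hθ : -1 < θ) (hR : 0 < R) (f : ℝ → ℝ≥0∞) :
    ∫⁻ r in Ioc 0 R, f r ∂(lam θ) = ENNReal.ofReal (omega θ * R ^ (θ + 1) / (θ + 1)) *
      ∫⁻ t in Ioi 0, ENNReal.ofReal (Real.exp (-t)) * f (R * Real.exp (-(t / (θ + 1)))) := by
  have hθ1 : 0 < θ + 1 := by linarith
  have hω := omega_pos hθ
  have himg : (fun t : ℝ => R * Real.exp (-(t / (θ + 1)))) '' Ici 0 = Ioc 0 R := by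
    ext r
    constructor
    · rintro ⟨t, ht, rfl⟩
      have ht : 0 ≤ t := ht
      refine ⟨by positivity, mul_le_of_le_one_right hR.le (Real.exp_le_one_iff.2 ?_)⟩
      have : 0 ≤ t / (θ + 1) := by positivity
      linarith
    · rintro ⟨h0, hr⟩
      refine ⟨(θ + 1) * Real.log (R / r), mul_nonneg hθ1.le (Real.log_nonneg
        ((one_le_div h0).2 hr)), ?_⟩
      simp only
      rw [mul_div_cancel_left₀ _ hθ1.ne', Real.exp_neg, Real.exp_log (by positivity)]
      field_simp
  have hd : ∀ t ∈ Ici (0 : ℝ), HasDerivWithinAt (fun t : ℝ => R * Real.exp (-(t / (θ + 1))))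
      (R * (Real.exp (-(t / (θ + 1))) * -(1 / (θ + 1)))) (Ici 0) t := fun t _ =>
    ((((hasDerivAt_id t).div_const (θ + 1)).neg.exp).const_mul R).hasDerivWithinAt
  have hinj : InjOn (fun t : ℝ => R * Real.exp (-(t / (θ + 1)))) (Ici 0) := fun s _ t _ h => by
    have := Real.exp_injective (mul_left_cancel₀ hR.ne' h)
    exact (div_left_inj' hθ1.ne').1 (neg_injective this)
  rw [setLIntegral_lam _ measurableSet_Ioc, inter_eq_left.2 fun r hr => hr.1, ← himg,
    lintegral_image_eq_lintegral_abs_deriv_mul measurableSet_Ici hd hinj,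
    ← lintegral_const_mul' _ _ ENNReal.ofReal_ne_top, setLIntegral_congr Ioi_ae_eq_Ici]
  refine setLIntegral_congr_fun measurableSet_Ici fun t _ => ?_
  rw [← mul_assoc, ← ENNReal.ofReal_mul (abs_nonneg _),
    ← mul_assoc (ENNReal.ofReal (_ / _)), ← ENNReal.ofReal_mul (by positivity)]
  congr 2
  have h1 : |R * (Real.exp (-(t / (θ + 1))) * -(1 / (θ + 1)))| =
      R * (Real.exp (-(t / (θ + 1))) * (1 / (θ + 1))) := by
    rw [← abs_neg, ← mul_neg, ← mul_neg, neg_neg, abs_of_pos (by positivity)]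
  have h2 : Real.exp (-t) = Real.exp (-(t / (θ + 1))) * Real.exp (-(t / (θ + 1))) ^ θ := by
    rw [← Real.exp_mul, ← Real.exp_add]
    congr 1
    field_simp
    ring
  rw [h1, h2, Real.mul_rpow hR.le (Real.exp_nonneg _), Real.rpow_add hR, Real.rpow_one]
  ring

/-- Averaging over an interval of length one: some value of `u` there is controlled by the
`L^p_θ` norm. -/
lemma exists_mul_rpow_le {p α θ : ℝ} (hp : 0 < p) (hθ : 0 ≤ θ) {u : ℝ → ℝ}
    (hu : u ∈ sobolevX p α θ) {r : ℝ} (hr : 1 ≤ r) :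
    ∃ s ∈ Ioc r (r + 1), omega θ * |u s| ^ p ≤ (lpNorm p θ u ^ p).toReal := by
  have hω := omega_pos (show -1 < θ by linarith)
  have hsub : Ioc r (r + 1) ⊆ Ioi 0 := fun s hs => (by linarith [hs.1] : (0 : ℝ) < s)
  have hm : AEMeasurable (fun s => ENNReal.ofReal (omega θ) * ‖u s‖ₑ ^ p)
      (volume.restrict (Ioc r (r + 1))) := by
    have : AEMeasurable u (volume.restrict (Ioc r (r + 1))) :=
      ((continuousOn_of_mem_sobolevX hu).mono hsub).aemeasurable measurableSet_Ioc
    fun_prop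
  have hvol : volume (Ioc r (r + 1)) = 1 := by simp
  obtain ⟨s, hs, h⟩ := exists_le_setLAverage (s := Ioc r (r + 1)) (by simp [hvol]) (by simp [hvol])
    hm
  rw [setLAverage_eq, hvol, div_one] at h
  have hB : lpNorm p θ u ^ p ≠ ∞ := ENNReal.rpow_ne_top_of_nonneg hp.le hu.2.2.1.eLpNorm_ne_top
  have hle : ENNReal.ofReal (omega θ) * ‖u s‖ₑ ^ p ≤ lpNorm p θ u ^ p := by
    refine h.trans ?_
    rw [lpNorm_rpow hp]
    refine le_trans ?_ (setLIntegral_le_lintegral (Ioc r (r + 1)) _)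
    rw [setLIntegral_lam _ measurableSet_Ioc, inter_eq_left.2 hsub]
    refine setLIntegral_mono' measurableSet_Ioc fun x hx => ?_
    gcongr
    exact le_mul_of_one_le_right hω.le (Real.one_le_rpow (by linarith [hx.1]) hθ)
  have := ENNReal.toReal_mono hB hle
  rw [ENNReal.toReal_mul, ENNReal.toReal_ofReal hω.le, ← ENNReal.toReal_rpow, toReal_enorm,
    Real.norm_eq_abs] at this
  exact ⟨s, hs, this⟩

/-- A bound, on `[1, ∞)`, for the functions of the unit ball. -/
noncomputable def outerBound (p θ : ℝ) : ℝ :=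
  (1 / omega θ) ^ (1 / p) + ((θ + 1) / muCrit (p - 1) θ) ^ (1 / (p / (p - 1)))

lemma abs_le_outerBound {p θ : ℝ} (hp : 1 < p) (hθ : 0 ≤ θ) {u : ℝ → ℝ}
    (hu : u ∈ sobolevX p (p - 1) θ) (hu1 : lpNorm p θ u ^ p ≤ 1)
    (hu2 : lpNorm p (p - 1) (deriv u) ^ p ≤ 1) {r : ℝ} (hr : 1 ≤ r) :
    |u r| ≤ outerBound p θ := by
  have hp0 : 0 < p := by linarith
  have hp1 : 0 < p - 1 := by linarith
  have hω := omega_pos (show -1 < θ by linarith)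
  have hμ : 0 < muCrit (p - 1) θ := muCrit_pos (by linarith) (by linarith)
  obtain ⟨s, hs, hus⟩ := exists_mul_rpow_le hp0 hθ hu hr
  have hr0 : 0 < r := by linarith
  have hE1 := (energy_le hp0 u r s).trans hu2
  have hE := abs_sub_rpow_le_energy hp (by linarith : -1 < θ) hr0 hs.1.le
    (hu.1 r s hr0 hs.1.le) (ne_top_of_le_ne_top ENNReal.one_ne_top hE1)
  have hE2 : (energy p u r s).toReal ≤ 1 := by
    simpa using ENNReal.toReal_mono ENNReal.one_ne_top hE1
  have hB : (lpNorm p θ u ^ p).toReal ≤ 1 := by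
    simpa using ENNReal.toReal_mono ENNReal.one_ne_top hu1
  have h1 : |u s| ≤ (1 / omega θ) ^ (1 / p) := by
    rw [one_div p, Real.le_rpow_inv_iff_of_pos (abs_nonneg _) (by positivity) hp0,
      le_div_iff₀ hω]
    linarith
  have hlog : Real.log (s / r) ≤ 1 := by
    refine (Real.log_le_sub_one_of_pos (div_pos (hr0.trans hs.1) hr0)).trans ?_
    rw [sub_le_iff_le_add, div_le_iff₀ hr0]
    linarith [hs.2]
  have hlog0 : 0 ≤ Real.log (s / r) := Real.log_nonneg ((one_le_div hr0).2 hs.1.le)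
  have h2 : |u s - u r| ≤ ((θ + 1) / muCrit (p - 1) θ) ^ (1 / (p / (p - 1))) := by
    rw [Real.div_rpow (by linarith) hμ.le, le_div_iff₀ (by positivity), mul_comm]
    refine hE.trans ?_
    calc (energy p u r s).toReal ^ (1 / p) * ((θ + 1) * Real.log (s / r)) ^ (1 / (p / (p - 1)))
        ≤ 1 ^ (1 / p) * ((θ + 1) * 1) ^ (1 / (p / (p - 1))) := by gcongr
      _ = _ := by rw [Real.one_rpow, one_mul, mul_one]
  calc |u r| = |u s - (u s - u r)| := by ring_nf
    _ ≤ |u s| + |u s - u r| := abs_sub _ _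
    _ ≤ _ := add_le_add h1 h2

/-- Far from the origin `u` is bounded, and the functional is dominated by the `L^p_θ` norm. -/
lemma setLIntegral_phi_Ioi_le {p θ R σ : ℝ} (hp : 1 < p) (hθ : 0 ≤ θ) (hσ : 0 ≤ σ) {u : ℝ → ℝ}
    (hu : u ∈ sobolevX p (p - 1) θ) (hu1 : lpNorm p θ u ^ p ≤ 1)
    (hu2 : lpNorm p (p - 1) (deriv u) ^ p ≤ 1) (hR : 1 ≤ R) :
    ∫⁻ r in Ioi R, ENNReal.ofReal (phi p (σ * |u r| ^ (p / (p - 1)))) ∂(lam θ) ≤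
      ENNReal.ofReal (σ ^ ⌈p - 1⌉₊ * outerBound p θ ^ (p / (p - 1) * ⌈p - 1⌉₊ - p) *
        Real.exp (σ * outerBound p θ ^ (p / (p - 1)))) := by
  set C := σ ^ ⌈p - 1⌉₊ * outerBound p θ ^ (p / (p - 1) * ⌈p - 1⌉₊ - p) *
        Real.exp (σ * outerBound p θ ^ (p / (p - 1))) with hC
  have hM : 0 ≤ outerBound p θ := (abs_nonneg _).trans (abs_le_outerBound hp hθ hu hu1 hu2 le_rfl)
  have hC0 : 0 ≤ C := by positivity
  calc ∫⁻ r in Ioi R, ENNReal.ofReal (phi p (σ * |u r| ^ (p / (p - 1)))) ∂(lam θ)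
      ≤ ∫⁻ r in Ioi R, ENNReal.ofReal C * ‖u r‖ₑ ^ p ∂(lam θ) := by
        refine setLIntegral_mono' measurableSet_Ioi fun r hr => ?_
        have hr1 : 1 ≤ r := hR.trans (le_of_lt hr)
        rw [← ofReal_norm, ENNReal.ofReal_rpow_of_nonneg (norm_nonneg _) (by linarith),
          ← ENNReal.ofReal_mul hC0, Real.norm_eq_abs]
        exact ENNReal.ofReal_le_ofReal (phi_le_mul_rpow hp hσ (abs_nonneg _)
          (abs_le_outerBound hp hθ hu hu1 hu2 hr1))
    _ ≤ ∫⁻ r, ENNReal.ofReal C * ‖u r‖ₑ ^ p ∂(lam θ) := setLIntegral_le_lintegral _ _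
    _ = ENNReal.ofReal C * lpNorm p θ u ^ p := by
      rw [lintegral_const_mul' _ _ ENNReal.ofReal_ne_top, lpNorm_rpow (by linarith)]
    _ ≤ ENNReal.ofReal C := mul_le_of_le_one_right' hu1

/-- The part of `|u|` above its value at `R`, in the logarithmic variable and normalised by an upper
bound `a` of the gradient energy, satisfies the hypotheses of Moser's inequality. -/
lemma moserPair_of_mem_sobolevX {p θ R a : ℝ} (hp : 1 < p) (hθ : -1 < θ) {u : ℝ → ℝ}
    (hu : u ∈ sobolevX p (p - 1) θ) (hR : 0 < R) (ha : 0 < a)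
    (hD : lpNorm p (p - 1) (deriv u) ^ p ≤ ENNReal.ofReal a) :
    MoserPair p
      (fun t => muCrit (p - 1) θ ^ (1 / (p / (p - 1))) *
        max (|u (R * Real.exp (-(t / (θ + 1))))| - |u R|) 0 / a ^ (1 / p))
      (fun t => (energy p u (R * Real.exp (-(t / (θ + 1)))) R).toReal / a) := by
  have hp0 : 0 < p := by linarith
  have hp1 : 0 < p - 1 := by linarith
  have hθ1 : 0 < θ + 1 := by linarith
  have hμ : 0 < muCrit (p - 1) θ := muCrit_pos (by linarith) (by linarith)
  have hEle : ∀ x y, energy p u x y ≤ ENNReal.ofReal a := fun x y => (energy_le hp0 u x y).trans hD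
  have hEtop : ∀ x y, energy p u x y ≠ ∞ := fun x y =>
    ne_top_of_le_ne_top ENNReal.ofReal_ne_top (hEle x y)
  have hpos : ∀ t, 0 < R * Real.exp (-(t / (θ + 1))) := fun t => by positivity
  have hanti : ∀ s t, s ≤ t → R * Real.exp (-(t / (θ + 1))) ≤ R * Real.exp (-(s / (θ + 1))) :=
    fun s t hst => by gcongr
  have hleR : ∀ t, 0 ≤ t → R * Real.exp (-(t / (θ + 1))) ≤ R := fun t ht => by
    simpa using hanti 0 t ht
  have hdiff : ∀ s t, 0 ≤ s → s ≤ t →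
      (energy p u (R * Real.exp (-(t / (θ + 1)))) R).toReal =
        (energy p u (R * Real.exp (-(t / (θ + 1)))) (R * Real.exp (-(s / (θ + 1))))).toReal +
          (energy p u (R * Real.exp (-(s / (θ + 1)))) R).toReal := fun s t hs hst => by
    rw [energy_add p u (hanti s t hst) (hleR s hs), ENNReal.toReal_add (hEtop _ _) (hEtop _ _)]
  refine ⟨by simp, fun t _ => by positivity, by positivity, fun t _ => ?_, fun s t hs hst => ?_,
    fun s t hs hst => ?_⟩
  · rw [div_le_one ha]
    exact ENNReal.toReal_le_of_le_ofReal ha.le (hEle _ _)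
  · rw [hdiff s t hs hst]
    gcongr
    exact le_add_of_nonneg_left ENNReal.toReal_nonneg
  · rw [← sub_div, hdiff s t hs hst, add_sub_cancel_right, Real.div_rpow ENNReal.toReal_nonneg ha.le,
      ← mul_div_assoc, ← add_div]
    gcongr
    have h := abs_sub_rpow_le_energy hp hθ (hpos t) (hanti s t hst)
      (hu.1 _ _ (hpos t) (hanti s t hst)) (hEtop _ _)
    have hlog : (θ + 1) * Real.log (R * Real.exp (-(s / (θ + 1))) /
        (R * Real.exp (-(t / (θ + 1))))) = t - s := by
      rw [mul_div_mul_left _ _ hR.ne', ← Real.exp_sub, Real.log_exp]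
      field_simp
      ring
    rw [hlog] at h
    set x := u (R * Real.exp (-(s / (θ + 1))))
    set y := u (R * Real.exp (-(t / (θ + 1))))
    have hmax : max (|y| - |u R|) 0 ≤ max (|x| - |u R|) 0 + |x - y| := by
      have h1 := abs_sub_abs_le_abs_sub y x
      rw [abs_sub_comm] at h1
      refine max_le ?_ (by positivity)
      linarith [le_max_left (|x| - |u R|) 0]
    calc muCrit (p - 1) θ ^ (1 / (p / (p - 1))) * max (|y| - |u R|) 0
        ≤ muCrit (p - 1) θ ^ (1 / (p / (p - 1))) * (max (|x| - |u R|) 0 + |x - y|) := by gcongr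
      _ ≤ _ := by
        rw [mul_add]
        linarith

/-- The critical exponential integral near the origin. Since `‖u‖_{L^p_θ}^p` and the gradient
energy add up to at most one, the gap between the energy and one pays for the value `u R`. -/
lemma setLIntegral_exp_Ioc_le {p θ R : ℝ} (hp : 2 ≤ p) (hθ : 0 ≤ θ) {u : ℝ → ℝ}
    (hu : u ∈ sobolevX p (p - 1) θ)
    (hu1 : lpNorm p θ u ^ p + lpNorm p (p - 1) (deriv u) ^ p ≤ 1) (hu0 : lpNorm p θ u ≠ 0)
    (hR : 0 < R) (huR : omega θ * |u R| ^ p ≤ (lpNorm p θ u ^ p).toReal) :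
    ∫⁻ r in Ioc 0 R, ENNReal.ofReal
        (Real.exp (muCrit (p - 1) θ * |u r| ^ (p / (p - 1)))) ∂(lam θ) ≤
      ENNReal.ofReal (omega θ * R ^ (θ + 1) / (θ + 1)) *
        (ENNReal.ofReal (Real.exp (muCrit (p - 1) θ * (2 / omega θ) ^ (1 / (p - 1)))) *
          ∑' n : ℕ, ENNReal.ofReal (Real.exp (-n) * (n + 1) *
            (4 + 10 * (2 ^ (p - 1) * (p - 1))))) := by
  have hp0 : 0 < p := by linarith
  have hp1 : 0 < p - 1 := by linarith
  have hω := omega_pos (show -1 < θ by linarith)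
  have hμ : 0 < muCrit (p - 1) θ := muCrit_pos (by linarith) (by linarith)
  have hBtop : lpNorm p θ u ^ p ≠ ∞ :=
    ne_top_of_le_ne_top ENNReal.one_ne_top (le_self_add.trans hu1)
  have hDtop : lpNorm p (p - 1) (deriv u) ^ p ≠ ∞ :=
    ne_top_of_le_ne_top ENNReal.one_ne_top (le_add_self.trans hu1)
  set b := (lpNorm p θ u ^ p).toReal with hb
  have hb0 : 0 < b := ENNReal.toReal_pos (by
    rwa [Ne, ENNReal.rpow_eq_zero_iff_of_pos hp0]) hBtop
  have hbD : b + (lpNorm p (p - 1) (deriv u) ^ p).toReal ≤ 1 := by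
    rw [hb, ← ENNReal.toReal_add hBtop hDtop]
    simpa using ENNReal.toReal_mono ENNReal.one_ne_top hu1
  have hD0 : 0 ≤ (lpNorm p (p - 1) (deriv u) ^ p).toReal := ENNReal.toReal_nonneg
  -- Weights `1 - b/2` and `b/2`: the gradient energy is at most `1 - b`, and both weights stay
  -- positive even when `b = 1`.
  have hη : 0 < b / 2 := by linarith
  have hη1 : 0 < 1 - b / 2 := by linarith
  have hD : lpNorm p (p - 1) (deriv u) ^ p ≤ ENNReal.ofReal (1 - b / 2) := by
    rw [← ENNReal.ofReal_toReal hDtop]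
    exact ENNReal.ofReal_le_ofReal (by linarith)
  have hM := moserPair_of_mem_sobolevX (by linarith : 1 < p) (by linarith : -1 < θ) hu hR hη1 hD
  have hq : 1 - p / (p - 1) = -(1 / (p - 1)) := by
    field_simp
    ring
  have hq1 : 1 ≤ p / (p - 1) := by
    have : 0 < 1 / (p - 1) := by positivity
    linarith
  have hy : (b / 2) ^ (1 - p / (p - 1)) * |u R| ^ (p / (p - 1)) ≤
      (2 / omega θ) ^ (1 / (p - 1)) := by
    have h1 : |u R| ^ (p / (p - 1)) ≤ (b / omega θ) ^ (1 / (p - 1)) := by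
      calc |u R| ^ (p / (p - 1)) = (|u R| ^ p) ^ (1 / (p - 1)) := by
            rw [← Real.rpow_mul (abs_nonneg _), mul_one_div]
        _ ≤ (b / omega θ) ^ (1 / (p - 1)) := by
          gcongr
          rw [le_div_iff₀ hω]
          linarith
    calc (b / 2) ^ (1 - p / (p - 1)) * |u R| ^ (p / (p - 1))
        ≤ (b / 2) ^ (1 - p / (p - 1)) * (b / omega θ) ^ (1 / (p - 1)) := by gcongr
      _ = (2 / omega θ) ^ (1 / (p - 1)) := by
        rw [hq, Real.rpow_neg hη.le, ← Real.inv_rpow hη.le,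
          ← Real.mul_rpow (by positivity) (by positivity)]
        congr 1
        field_simp
  rw [setLIntegral_lam_Ioc (by linarith) hR]
  gcongr
  refine le_trans ?_ (mul_le_mul_right (hM.lintegral_exp_le hp) _)
  rw [← lintegral_const_mul' _ _ ENNReal.ofReal_ne_top]
  refine lintegral_mono fun t => ?_
  rw [← ENNReal.ofReal_mul (Real.exp_nonneg _), ← ENNReal.ofReal_mul (Real.exp_nonneg _),
    ← Real.exp_add, ← Real.exp_add]
  refine ENNReal.ofReal_le_ofReal (Real.exp_le_exp.2 ?_)
  set x := |u (R * Real.exp (-(t / (θ + 1))))| with hx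
  set z := max (x - |u R|) 0 with hz
  have hz0 : 0 ≤ z := le_max_right _ _
  have h1 : x ^ (p / (p - 1)) ≤ (1 - b / 2) ^ (1 - p / (p - 1)) * z ^ (p / (p - 1)) +
      (b / 2) ^ (1 - p / (p - 1)) * |u R| ^ (p / (p - 1)) := by
    refine le_trans ?_ (add_rpow_le_split hq1 hz0 (abs_nonneg _) hη (by linarith))
    have : x ≤ z + |u R| := by linarith [le_max_left (x - |u R|) 0]
    gcongr
  have h2 : (muCrit (p - 1) θ ^ (1 / (p / (p - 1))) * z / (1 - b / 2) ^ (1 / p)) ^ (p / (p - 1)) =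
      muCrit (p - 1) θ * ((1 - b / 2) ^ (1 - p / (p - 1)) * z ^ (p / (p - 1))) := by
    rw [Real.div_rpow (by positivity) (by positivity), Real.mul_rpow (by positivity) hz0,
      ← Real.rpow_mul hμ.le, one_div_mul_cancel (by positivity), Real.rpow_one,
      ← Real.rpow_mul hη1.le, hq, Real.rpow_neg hη1.le,
      show 1 / p * (p / (p - 1)) = 1 / (p - 1) by field_simp]
    ring
  rw [h2]
  have h3 := mul_le_mul_of_nonneg_left (h1.trans (add_le_add_right hy _)) hμ.le
  rw [mul_add] at h3
  linarith

/-- The critical Trudinger–Moser inequality on the half-line. -/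
theorem TMC_muCrit_lt_top {p θ : ℝ} (hp : 2 ≤ p) (hθ : 0 ≤ θ) :
    TMC p (p - 1) θ (muCrit (p - 1) θ) < ∞ := by
  have hp0 : 0 < p := by linarith
  have hp1 : 0 < p - 1 := by linarith
  have hω := omega_pos (show -1 < θ by linarith)
  have hμ : 0 < muCrit (p - 1) θ := muCrit_pos (by linarith) (by linarith)
  refine lt_of_le_of_lt (iSup₂_le fun u hu => ?_) (ENNReal.add_lt_top.2
    ⟨ENNReal.mul_lt_top (ENNReal.ofReal_lt_top (r := omega θ * 2 ^ (θ + 1) / (θ + 1)))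
      (ENNReal.mul_lt_top (ENNReal.ofReal_lt_top
        (r := Real.exp (muCrit (p - 1) θ * (2 / omega θ) ^ (1 / (p - 1)))))
        (tsum_moser_lt_top (p := p) (by linarith))),
      ENNReal.ofReal_lt_top (r := muCrit (p - 1) θ ^ ⌈p - 1⌉₊ *
        outerBound p θ ^ (p / (p - 1) * ⌈p - 1⌉₊ - p) *
        Real.exp (muCrit (p - 1) θ * outerBound p θ ^ (p / (p - 1))))⟩)
  obtain ⟨huX, hu1⟩ := hu
  rw [fullNorm_le_one_iff hp0] at hu1
  by_cases hu0 : lpNorm p θ u = 0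
  · rw [expFunctional_eq_zero (by linarith) _ huX.2.2.1.1 hu0]
    exact zero_le
  obtain ⟨R, ⟨hR1, hR2⟩, huR⟩ := exists_mul_rpow_le hp0 hθ huX le_rfl
  have hR0 : 0 < R := by linarith
  have hsplit : expFunctional p θ (muCrit (p - 1) θ) u =
      ∫⁻ r in Ioc 0 R, ENNReal.ofReal (phi p (muCrit (p - 1) θ * |u r| ^ (p / (p - 1)))) ∂(lam θ) +
      ∫⁻ r in Ioi R, ENNReal.ofReal
        (phi p (muCrit (p - 1) θ * |u r| ^ (p / (p - 1)))) ∂(lam θ) := by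
    rw [← lintegral_union measurableSet_Ioi
      (disjoint_left.2 fun x hx hx' => not_lt.2 hx.2 hx'), Ioc_union_Ioi_eq_Ioi hR0.le]
    rw [expFunctional, setLIntegral_lam _ measurableSet_Ioi, inter_self, lintegral_lam]
  rw [hsplit]
  refine add_le_add ?_ (setLIntegral_phi_Ioi_le (by linarith) hθ hμ.le huX
    (le_self_add.trans hu1) (le_add_self.trans hu1) hR1.le)
  calc ∫⁻ r in Ioc 0 R, ENNReal.ofReal (phi p (muCrit (p - 1) θ * |u r| ^ (p / (p - 1)))) ∂(lam θ)
      ≤ ∫⁻ r in Ioc 0 R, ENNReal.ofReal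
        (Real.exp (muCrit (p - 1) θ * |u r| ^ (p / (p - 1)))) ∂(lam θ) :=
        lintegral_mono fun r => ENNReal.ofReal_le_ofReal (phi_le_exp p (by positivity))
    _ ≤ _ := setLIntegral_exp_Ioc_le hp hθ huX hu1 hu0 hR0 huR
    _ ≤ _ := by
      gcongr
      linarith

/-! ### Dilations and the relation between the two suprema -/

lemma absolutelyContinuousOnInterval_comp_mul {u : ℝ → ℝ} {τ a b : ℝ} (hτ : 0 < τ)
    (hu : AbsolutelyContinuousOnInterval u (τ * a) (τ * b)) :
    AbsolutelyContinuousOnInterval (fun r => u (τ * r)) a b := by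
  rw [absolutelyContinuousOnInterval_iff] at hu ⊢
  intro ε hε
  obtain ⟨δ, hδ, h⟩ := hu ε hε
  refine ⟨δ / τ, div_pos hδ hτ, fun E hE hEδ => ?_⟩
  refine h (E.1, fun i => (τ * (E.2 i).1, τ * (E.2 i).2)) ⟨fun i hi => ?_, ?_⟩ ?_
  · simpa only [mem_uIcc, mul_le_mul_iff_right₀ hτ] using hE.1 i hi
  · intro i hi j hj hij
    have hd : Disjoint (uIoc (E.2 i).1 (E.2 i).2) (uIoc (E.2 j).1 (E.2 j).2) := hE.2 hi hj hij
    have hscale : ∀ x y z : ℝ, z ∈ uIoc (τ * x) (τ * y) → z / τ ∈ uIoc x y := fun x y z hz => by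
      rw [mem_uIoc] at hz ⊢
      simpa only [lt_div_iff₀ hτ, div_le_iff₀ hτ, mul_comm] using hz
    exact disjoint_left.2 fun z hz hz' => disjoint_left.1 hd (hscale _ _ z hz) (hscale _ _ z hz')
  · simp only [Real.dist_eq, ← mul_sub, abs_mul, abs_of_pos hτ, ← Finset.mul_sum]
    simp only [Real.dist_eq] at hEδ
    rwa [lt_div_iff₀ hτ, mul_comm] at hEδ

lemma aestronglyMeasurable_lam {u : ℝ → ℝ} (hu : ContinuousOn u (Ioi 0)) (θ : ℝ) :
    AEStronglyMeasurable u (lam θ) :=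
  (hu.aestronglyMeasurable measurableSet_Ioi).mono_ac (withDensity_absolutelyContinuous _ _)

lemma deriv_const_mul_comp_mul (c τ : ℝ) (u : ℝ → ℝ) :
    deriv (fun r => c * u (τ * r)) = fun r => (c * τ) * deriv u (τ * r) := by
  ext r
  rw [deriv_const_mul_field, deriv_comp_mul_left, smul_eq_mul, mul_assoc]

lemma lpNorm_rpow_const_mul_comp_mul {p : ℝ} (hp : 0 < p) (θ c : ℝ) {τ : ℝ} (hτ : 0 < τ)
    (u : ℝ → ℝ) :
    lpNorm p θ (fun r => c * u (τ * r)) ^ p =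
      ENNReal.ofReal (|c| ^ p * τ ^ (-(θ + 1))) * lpNorm p θ u ^ p := by
  rw [lpNorm_const_mul θ c fun r => u (τ * r), ENNReal.mul_rpow_of_nonneg _ _ hp.le,
    lpNorm_rpow_comp_mul hp θ hτ, ← ofReal_norm, Real.norm_eq_abs,
    ENNReal.ofReal_rpow_of_nonneg (abs_nonneg _) hp.le, ← mul_assoc,
    ← ENNReal.ofReal_mul (by positivity)]

/-- The gradient energy is invariant under dilations. -/
lemma lpNorm_deriv_rpow_const_mul_comp_mul {p : ℝ} (hp : 0 < p) (c : ℝ) {τ : ℝ} (hτ : 0 < τ)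
    (u : ℝ → ℝ) :
    lpNorm p (p - 1) (deriv fun r => c * u (τ * r)) ^ p =
      ENNReal.ofReal (|c| ^ p) * lpNorm p (p - 1) (deriv u) ^ p := by
  rw [deriv_const_mul_comp_mul, lpNorm_rpow_const_mul_comp_mul hp _ _ hτ]
  congr 2
  rw [abs_mul, abs_of_pos hτ, Real.mul_rpow (abs_nonneg _) hτ.le, mul_assoc, ← Real.rpow_add hτ]
  simp

lemma const_mul_comp_mul_mem_sobolevX {p θ : ℝ} (hp : 0 < p) (c : ℝ) {τ : ℝ} (hτ : 0 < τ)
    {u : ℝ → ℝ} (hu : u ∈ sobolevX p (p - 1) θ) :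
    (fun r => c * u (τ * r)) ∈ sobolevX p (p - 1) θ := by
  have hfin : ∀ β : ℝ, ∀ v : ℝ → ℝ, lpNorm p β v ^ p < ∞ → lpNorm p β v < ∞ := fun β v h =>
    (ENNReal.rpow_lt_top_iff_of_pos hp).1 h
  refine ⟨fun a b ha hab => (absolutelyContinuousOnInterval_comp_mul hτ
    (hu.1 _ _ (by positivity) (by gcongr))).const_mul c, ?_, ⟨?_, hfin _ _ ?_⟩, ⟨?_, hfin _ _ ?_⟩⟩
  · simpa using (hu.2.1.comp (tendsto_id.const_mul_atTop hτ)).const_mul c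
  · refine aestronglyMeasurable_lam (continuousOn_const.mul
      ((continuousOn_of_mem_sobolevX hu).comp (by fun_prop) fun r hr => mul_pos hτ hr)) θ
  · rw [lpNorm_rpow_const_mul_comp_mul hp _ _ hτ]
    exact ENNReal.mul_lt_top ENNReal.ofReal_lt_top
      (ENNReal.rpow_lt_top_of_nonneg hp.le hu.2.2.1.eLpNorm_ne_top)
  · exact (measurable_deriv _).aestronglyMeasurable
  · rw [lpNorm_deriv_rpow_const_mul_comp_mul hp _ hτ]
    exact ENNReal.mul_lt_top ENNReal.ofReal_lt_top
      (ENNReal.rpow_lt_top_of_nonneg hp.le hu.2.2.2.eLpNorm_ne_top)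

lemma expFunctional_const_mul_comp_mul (p θ σ : ℝ) {c τ : ℝ} (hc : 0 ≤ c) (hτ : 0 < τ)
    (u : ℝ → ℝ) :
    expFunctional p θ σ (fun r => c * u (τ * r)) =
      ENNReal.ofReal (τ ^ (-(θ + 1))) * expFunctional p θ (σ * c ^ (p / (p - 1))) u := by
  rw [expFunctional, expFunctional, ← lintegral_lam_comp_mul θ hτ]
  simp only [abs_mul, abs_of_nonneg hc, Real.mul_rpow hc (abs_nonneg _), mul_assoc]

/-- A competitor for the subcritical problem becomes one for the critical problem after
multiplication by `(μ/σ)^((p-1)/p)` and a dilation which fills the room left in the full norm. -/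
theorem mul_TMSC_le_TMC {p θ μ σ : ℝ} (hp : 1 < p) (hθ : -1 < θ) (hμ : 0 < μ) (hμσ : μ < σ) :
    ENNReal.ofReal ((1 - (μ / σ) ^ (p - 1)) / (μ / σ) ^ (p - 1)) * TMSC p (p - 1) θ μ ≤
      TMC p (p - 1) θ σ := by
  have hp0 : 0 < p := by linarith
  have hp1 : 0 < p - 1 := by linarith
  have hθ1 : 0 < θ + 1 := by linarith
  have hσ : 0 < σ := hμ.trans hμσ
  set k := (μ / σ) ^ (p - 1) with hk
  have hk0 : 0 < k := by positivity
  have hk1 : k < 1 := Real.rpow_lt_one (by positivity) ((div_lt_one hσ).2 hμσ) hp1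
  have hk2 : 0 < 1 - k := by linarith
  rw [TMSC, ENNReal.mul_iSup]
  refine iSup_le fun u => ?_
  rw [ENNReal.mul_iSup]
  refine iSup_le fun hu => ?_
  obtain ⟨huX, hu0, hu1⟩ := hu
  have hBtop : lpNorm p θ u ^ p ≠ ∞ :=
    ENNReal.rpow_ne_top_of_nonneg hp0.le huX.2.2.1.eLpNorm_ne_top
  set b := (lpNorm p θ u ^ p).toReal with hb
  have hbB : lpNorm p θ u ^ p = ENNReal.ofReal b := (ENNReal.ofReal_toReal hBtop).symm
  have hb0 : 0 < b := ENNReal.toReal_pos (by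
    rwa [Ne, ENNReal.rpow_eq_zero_iff_of_pos hp0]) hBtop
  set τ := (k * b / (1 - k)) ^ (1 / (θ + 1)) with hτ
  have hτ0 : 0 < τ := by positivity
  have hτ1 : τ ^ (-(θ + 1)) = (1 - k) / (k * b) := by
    rw [Real.rpow_neg hτ0.le, hτ, ← Real.rpow_mul (by positivity), one_div_mul_cancel hθ1.ne',
      Real.rpow_one, inv_div]
  set c := (μ / σ) ^ ((p - 1) / p) with hc
  have hc0 : 0 ≤ c := by positivity
  have hc1 : |c| ^ p = k := by
    rw [abs_of_nonneg hc0, hc, ← Real.rpow_mul (by positivity), div_mul_cancel₀ _ hp0.ne']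
  have hc2 : σ * c ^ (p / (p - 1)) = μ := by
    rw [hc, ← Real.rpow_mul (by positivity), div_mul_div_cancel₀ hp0.ne', div_self hp1.ne',
      Real.rpow_one]
    field_simp
  have hv : (fun r => c * u (τ * r)) ∈
      {u | u ∈ sobolevX p (p - 1) θ ∧ fullNorm p (p - 1) θ u ≤ 1} := by
    refine ⟨const_mul_comp_mul_mem_sobolevX hp0 c hτ0 huX, ?_⟩
    rw [fullNorm_le_one_iff hp0, lpNorm_rpow_const_mul_comp_mul hp0 _ _ hτ0,
      lpNorm_deriv_rpow_const_mul_comp_mul hp0 _ hτ0, hc1, hτ1, hbB,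
      ← ENNReal.ofReal_mul (by positivity)]
    have hD : lpNorm p (p - 1) (deriv u) ^ p ≤ 1 := ENNReal.rpow_le_one hu1 hp0.le
    calc ENNReal.ofReal (k * ((1 - k) / (k * b)) * b) +
          ENNReal.ofReal k * lpNorm p (p - 1) (deriv u) ^ p
        ≤ ENNReal.ofReal (k * ((1 - k) / (k * b)) * b) + ENNReal.ofReal k := by
          gcongr
          exact mul_le_of_le_one_right' hD
      _ = 1 := by
        rw [← ENNReal.ofReal_add (by positivity) hk0.le,
          show k * ((1 - k) / (k * b)) * b + k = 1 by field_simp; ring, ENNReal.ofReal_one]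
  refine le_trans (le_of_eq ?_) (le_iSup₂ (f := fun v (_ : v ∈
    {u | u ∈ sobolevX p (p - 1) θ ∧ fullNorm p (p - 1) θ u ≤ 1}) => expFunctional p θ σ v) _ hv)
  rw [expFunctional_const_mul_comp_mul p θ σ hc0 hτ0, hc2, hτ1, hbB,
    div_eq_mul_inv (expFunctional _ _ _ _),
    ← ENNReal.ofReal_inv_of_pos hb0, mul_comm (expFunctional _ _ _ _), ← mul_assoc,
    ← ENNReal.ofReal_mul (by positivity)]
  congr 2
  field_simp

/-- Dividing a competitor for the critical problem by the `L^p` norm of its derivative gives one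
for a subcritical problem, whose parameter is determined by that norm. -/
theorem TMC_le_iSup_TMSC {p θ σ : ℝ} (hp : 1 < p) (hσ : 0 < σ) :
    TMC p (p - 1) θ σ ≤ ⨆ μ ∈ Ioo 0 σ,
      ENNReal.ofReal ((1 - (μ / σ) ^ (p - 1)) / (μ / σ) ^ (p - 1)) * TMSC p (p - 1) θ μ := by
  have hp0 : 0 < p := by linarith
  have hp1 : 0 < p - 1 := by linarith
  refine iSup₂_le fun u hu => ?_
  obtain ⟨huX, hu1⟩ := hu
  rw [fullNorm_le_one_iff hp0] at hu1
  by_cases hu0 : lpNorm p θ u = 0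
  · rw [expFunctional_eq_zero hp _ huX.2.2.1.1 hu0]
    exact zero_le
  have hD0 : lpNorm p (p - 1) (deriv u) ≠ 0 := fun h => hu0 <| by
    refine (eLpNorm_congr_ae ?_).trans eLpNorm_zero
    filter_upwards [ae_lam_pos θ] with r hr
    exact eq_zero_of_lpNorm_deriv_eq_zero hp huX h hr
  have hBtop : lpNorm p θ u ^ p ≠ ∞ :=
    ne_top_of_le_ne_top ENNReal.one_ne_top (le_self_add.trans hu1)
  have hDtop : lpNorm p (p - 1) (deriv u) ^ p ≠ ∞ :=
    ne_top_of_le_ne_top ENNReal.one_ne_top (le_add_self.trans hu1)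
  set b := (lpNorm p θ u ^ p).toReal with hb
  set a := (lpNorm p (p - 1) (deriv u) ^ p).toReal with ha
  have hbB : lpNorm p θ u ^ p = ENNReal.ofReal b := (ENNReal.ofReal_toReal hBtop).symm
  have haD : lpNorm p (p - 1) (deriv u) ^ p = ENNReal.ofReal a := (ENNReal.ofReal_toReal hDtop).symm
  have hb0 : 0 < b := ENNReal.toReal_pos (by
    rwa [Ne, ENNReal.rpow_eq_zero_iff_of_pos hp0]) hBtop
  have ha0 : 0 < a := ENNReal.toReal_pos (by
    rwa [Ne, ENNReal.rpow_eq_zero_iff_of_pos hp0]) hDtop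
  have hba : b + a ≤ 1 := by
    rw [hb, ha, ← ENNReal.toReal_add hBtop hDtop]
    simpa using ENNReal.toReal_mono ENNReal.one_ne_top hu1
  set μ := σ * a ^ (1 / (p - 1)) with hμ
  have hμσ : μ / σ = a ^ (1 / (p - 1)) := by
    rw [hμ]
    field_simp
  have hμmem : μ ∈ Ioo 0 σ := ⟨by positivity, mul_lt_of_lt_one_right hσ
    (Real.rpow_lt_one ha0.le (by linarith) (by positivity))⟩
  have hk : (μ / σ) ^ (p - 1) = a := by
    rw [hμσ, ← Real.rpow_mul ha0.le, one_div_mul_cancel hp1.ne', Real.rpow_one]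
  refine le_trans ?_ (le_iSup₂ (f := fun μ (_ : μ ∈ Ioo 0 σ) =>
    ENNReal.ofReal ((1 - (μ / σ) ^ (p - 1)) / (μ / σ) ^ (p - 1)) * TMSC p (p - 1) θ μ) μ hμmem)
  simp only [hk]
  set c := a ^ (-(1 / p)) with hc
  have hc0 : 0 ≤ c := by positivity
  have hc1 : |c| ^ p = a⁻¹ := by
    rw [abs_of_nonneg hc0, hc, ← Real.rpow_mul ha0.le, neg_mul, one_div_mul_cancel hp0.ne',
      Real.rpow_neg_one]
  have hc2 : μ * c ^ (p / (p - 1)) = σ := by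
    rw [hc, ← Real.rpow_mul ha0.le, hμ, mul_assoc, ← Real.rpow_add ha0,
      show 1 / (p - 1) + -(1 / p) * (p / (p - 1)) = 0 by field_simp; ring, Real.rpow_zero, mul_one]
  have hvB := lpNorm_rpow_const_mul_comp_mul hp0 θ c one_pos u
  have hvD := lpNorm_deriv_rpow_const_mul_comp_mul hp0 c one_pos u
  have hvF := expFunctional_const_mul_comp_mul p θ μ hc0 one_pos u
  have hvX := const_mul_comp_mul_mem_sobolevX (θ := θ) hp0 c one_pos huX
  rw [hc1, Real.one_rpow, mul_one, hbB, ← ENNReal.ofReal_mul (by positivity)] at hvB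
  rw [hc1, haD, ← ENNReal.ofReal_mul (by positivity), inv_mul_cancel₀ ha0.ne',
    ENNReal.ofReal_one] at hvD
  rw [hc2, Real.one_rpow, ENNReal.ofReal_one, one_mul] at hvF
  set v := fun r => c * u (1 * r) with hv
  have hvmem : v ∈ {u | u ∈ sobolevX p (p - 1) θ ∧ lpNorm p θ u ≠ 0 ∧
      lpNorm p (p - 1) (deriv u) ≤ 1} := by
    refine ⟨hvX, fun h => ?_, ?_⟩
    · rw [h, ENNReal.zero_rpow_of_pos hp0, eq_comm, ENNReal.ofReal_eq_zero] at hvB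
      exact absurd hvB (not_le.2 (by positivity))
    · rw [← ENNReal.rpow_le_rpow_iff hp0, hvD, ENNReal.one_rpow]
  have hle : expFunctional p θ μ v / lpNorm p θ v ^ p ≤ TMSC p (p - 1) θ μ :=
    le_iSup₂ (f := fun v (_ : v ∈ {u | u ∈ sobolevX p (p - 1) θ ∧ lpNorm p θ u ≠ 0 ∧
      lpNorm p (p - 1) (deriv u) ≤ 1}) => expFunctional p θ μ v / lpNorm p θ v ^ p) v hvmem
  rw [hvF, hvB, ENNReal.div_le_iff (by simp; positivity) ENNReal.ofReal_ne_top] at hle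
  refine hle.trans ?_
  rw [mul_comm]
  gcongr
  rw [div_eq_inv_mul]
  gcongr
  linarith

/-! ### Moser's functions and sharpness -/

lemma lam_Ioc {θ R : ℝ} (hθ : -1 < θ) (hR : 0 < R) :
    lam θ (Ioc 0 R) = ENNReal.ofReal (omega θ * R ^ (θ + 1) / (θ + 1)) := by
  have h := setLIntegral_lam_Ioc hθ hR fun _ => 1
  have h1 : ∫⁻ t in Ioi (0 : ℝ), ENNReal.ofReal (Real.exp (-t)) = 1 := by
    rw [← ofReal_integral_eq_lintegral_ofReal (integrableOn_exp_neg_Ioi 0)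
      (ae_of_all _ fun t => Real.exp_nonneg _), integral_exp_neg_Ioi_zero, ENNReal.ofReal_one]
  simpa [h1] using h

/-- Moser's function before normalisation: `log (1 / r)` truncated to take values in `[0, N]`. -/
noncomputable def truncLog (N r : ℝ) : ℝ := max 0 (min N (-Real.log r))

lemma truncLog_nonneg (N r : ℝ) : 0 ≤ truncLog N r := le_max_left _ _

lemma truncLog_le {N : ℝ} (hN : 0 ≤ N) (r : ℝ) : truncLog N r ≤ N :=
  max_le hN (min_le_left _ _)

lemma truncLog_of_one_le {N r : ℝ} (hr : 1 ≤ r) : truncLog N r = 0 :=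
  max_eq_left ((min_le_right _ _).trans (neg_nonpos.2 (Real.log_nonneg hr)))

lemma truncLog_of_le_exp {N r : ℝ} (hN : 0 ≤ N) (hr0 : 0 < r) (hr : r ≤ Real.exp (-N)) :
    truncLog N r = N := by
  have : N ≤ -Real.log r := by
    have := (Real.log_le_iff_le_exp hr0).2 hr
    linarith
  rw [truncLog, min_eq_left this, max_eq_right hN]

lemma truncLog_of_mem_Ioo {N r : ℝ} (hr : r ∈ Ioo (Real.exp (-N)) 1) :
    truncLog N r = -Real.log r := by
  have h0 : 0 < r := (Real.exp_pos _).trans hr.1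
  have h1 := (Real.lt_log_iff_exp_lt h0).2 hr.1
  have h2 := Real.log_neg h0 hr.2
  rw [truncLog, min_eq_right (by linarith), max_eq_right (by linarith)]

lemma absolutelyContinuousOnInterval_truncLog (N : ℝ) {a b : ℝ} (ha : 0 < a) (hab : a ≤ b) :
    AbsolutelyContinuousOnInterval (truncLog N) a b := by
  have hlog : AbsolutelyContinuousOnInterval Real.log a b := by
    refine ContDiffOn.absolutelyContinuousOnInterval (contDiffOn_id.log fun x hx => ?_)
    rw [uIcc_of_le hab] at hx
    exact (ha.trans_le hx.1).ne'
  rw [absolutelyContinuousOnInterval_iff] at hlog ⊢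
  intro ε hε
  obtain ⟨δ, hδ, h⟩ := hlog ε hε
  refine ⟨δ, hδ, fun E hE hEδ => lt_of_le_of_lt (Finset.sum_le_sum fun i _ => ?_) (h E hE hEδ)⟩
  rw [Real.dist_eq, Real.dist_eq]
  refine (abs_max_sub_max_le_max _ _ _ _).trans (max_le (by simp) ?_)
  refine (abs_min_sub_min_le_max _ _ _ _).trans (max_le (by simp) ?_)
  rw [neg_sub_neg, abs_sub_comm]

lemma enorm_deriv_truncLog_rpow_le {p N : ℝ} (hp : 0 < p) (hN : 0 ≤ N) {r : ℝ} (hr : 0 < r)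
    (h1 : r ≠ Real.exp (-N)) (h2 : r ≠ 1) :
    ‖deriv (truncLog N) r‖ₑ ^ p ≤
      (Ioc (Real.exp (-N)) 1).indicator (fun r => ENNReal.ofReal (r ^ (-p))) r := by
  have hconst : ∀ c : ℝ, truncLog N =ᶠ[𝓝 r] (fun _ => c) → ‖deriv (truncLog N) r‖ₑ ^ p ≤
      (Ioc (Real.exp (-N)) 1).indicator (fun r => ENNReal.ofReal (r ^ (-p))) r := fun c h => by
    rw [h.deriv_eq, deriv_const, enorm_zero, ENNReal.zero_rpow_of_pos hp]
    exact zero_le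
  rcases lt_or_gt_of_ne h1 with h1 | h1
  · refine hconst N ?_
    filter_upwards [Ioo_mem_nhds hr h1] with s hs
    exact truncLog_of_le_exp hN hs.1 hs.2.le
  rcases lt_or_gt_of_ne h2 with h2 | h2
  · have h : truncLog N =ᶠ[𝓝 r] fun s => -Real.log s := by
      filter_upwards [Ioo_mem_nhds h1 h2] with s hs
      exact truncLog_of_mem_Ioo hs
    have hd : ‖deriv (truncLog N) r‖ₑ = ENNReal.ofReal r⁻¹ := by
      rw [h.deriv_eq, deriv.fun_neg, Real.deriv_log, enorm_neg, ← ofReal_norm, Real.norm_eq_abs,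
        abs_of_pos (by positivity)]
    rw [hd, indicator_of_mem (show r ∈ Ioc (Real.exp (-N)) 1 from ⟨h1, h2.le⟩),
      ENNReal.ofReal_rpow_of_nonneg (by positivity) hp.le, Real.inv_rpow hr.le, Real.rpow_neg hr.le]
  · refine hconst 0 ?_
    filter_upwards [Ioi_mem_nhds h2] with s hs
    exact truncLog_of_one_le (le_of_lt hs)

lemma lpNorm_deriv_truncLog_le {p N : ℝ} (hp : 1 < p) (hN : 0 ≤ N) :
    lpNorm p (p - 1) (deriv (truncLog N)) ^ p ≤ ENNReal.ofReal (omega (p - 1) * N) := by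
  have hω : 0 < omega (p - 1) := omega_pos (by linarith)
  have he : Real.exp (-N) ≤ 1 := Real.exp_le_one_iff.2 (by linarith)
  have hpos : Ioc (Real.exp (-N)) 1 ⊆ Ioi 0 := fun r hr => (Real.exp_pos _).trans hr.1
  have hne : ∀ x : ℝ, ∀ᵐ r ∂(lam (p - 1)), r ≠ x := fun x =>
    (lam_absolutelyContinuous _).ae_le (Measure.ae_ne volume x)
  rw [lpNorm_rpow (by linarith)]
  calc ∫⁻ r, ‖deriv (truncLog N) r‖ₑ ^ p ∂(lam (p - 1))
      ≤ ∫⁻ r, (Ioc (Real.exp (-N)) 1).indicator (fun r => ENNReal.ofReal (r ^ (-p))) r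
          ∂(lam (p - 1)) := by
        refine lintegral_mono_ae ?_
        filter_upwards [ae_lam_pos (p - 1), hne (Real.exp (-N)), hne 1] with r hr h1 h2
        exact enorm_deriv_truncLog_rpow_le (by linarith) hN hr h1 h2
    _ = ∫⁻ r in Ioc (Real.exp (-N)) 1, ENNReal.ofReal (omega (p - 1) * r⁻¹) := by
      rw [lintegral_indicator measurableSet_Ioc, setLIntegral_lam _ measurableSet_Ioc,
        inter_eq_left.2 hpos]
      refine setLIntegral_congr_fun measurableSet_Ioc fun r hr => ?_
      have hr : 0 < r := (Real.exp_pos _).trans hr.1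
      rw [← ENNReal.ofReal_mul (by positivity), mul_assoc, ← Real.rpow_add hr,
        show p - 1 + -p = -1 by ring, Real.rpow_neg_one]
    _ = ENNReal.ofReal (omega (p - 1) * N) := by
      rw [setLIntegral_const_mul_inv (Real.exp_pos _) he hω.le, one_div, ← Real.exp_neg,
        Real.log_exp, neg_neg]

lemma lpNorm_truncLog_le {p θ N : ℝ} (hp : 0 < p) (hθ : -1 < θ) (hN : 0 ≤ N) :
    lpNorm p θ (truncLog N) ^ p ≤ ENNReal.ofReal (N ^ p * (omega θ / (θ + 1))) := by
  rw [lpNorm_rpow hp]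
  calc ∫⁻ r, ‖truncLog N r‖ₑ ^ p ∂(lam θ)
      ≤ ∫⁻ r, (Ioc (0 : ℝ) 1).indicator (fun _ => ENNReal.ofReal (N ^ p)) r ∂(lam θ) := by
        refine lintegral_mono_ae ?_
        filter_upwards [ae_lam_pos θ] with r hr
        rcases le_or_gt r 1 with h | h
        · rw [indicator_of_mem (show r ∈ Ioc (0 : ℝ) 1 from ⟨hr, h⟩), ← ofReal_norm, Real.norm_eq_abs,
            ENNReal.ofReal_rpow_of_nonneg (abs_nonneg _) hp.le, abs_of_nonneg (truncLog_nonneg N r)]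
          have := truncLog_nonneg N r
          have := truncLog_le hN r
          gcongr
        · rw [truncLog_of_one_le h.le, enorm_zero, ENNReal.zero_rpow_of_pos hp]
          exact zero_le
    _ = _ := by
      rw [lintegral_indicator_const measurableSet_Ioc, lam_Ioc hθ one_pos, Real.one_rpow, mul_one,
        ← ENNReal.ofReal_mul (by positivity)]

/-- The functional is bounded below by its part on the plateau `(0, e^{-N}]`. -/
lemma mul_lam_le_of_plateau {θ N : ℝ} (hθ : -1 < θ) (hN : 0 ≤ N) (F : ℝ → ℝ≥0∞) :
    F N * ENNReal.ofReal (omega θ * Real.exp (-((θ + 1) * N)) / (θ + 1)) ≤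
      ∫⁻ r, F (truncLog N r) ∂(lam θ) := by
  have he : Real.exp (-((θ + 1) * N)) = Real.exp (-N) ^ (θ + 1) := by
    rw [← Real.exp_mul]
    ring_nf
  rw [he, ← lam_Ioc hθ (Real.exp_pos _), ← setLIntegral_const]
  refine le_trans (le_of_eq ?_) (setLIntegral_le_lintegral (Ioc 0 (Real.exp (-N))) _)
  refine setLIntegral_congr_fun measurableSet_Ioc fun r hr => ?_
  rw [truncLog_of_le_exp hN hr.1 hr.2]

lemma lpNorm_truncLog_ne_zero {p θ N : ℝ} (hp : 0 < p) (hθ : -1 < θ) (hN : 0 < N) :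
    lpNorm p θ (truncLog N) ≠ 0 := fun h => by
  have h1 := mul_lam_le_of_plateau hθ hN.le fun x => ‖x‖ₑ ^ p
  have hω := omega_pos hθ
  have hθ1 : 0 < θ + 1 := by linarith
  rw [← lpNorm_rpow hp, h, ENNReal.zero_rpow_of_pos hp, nonpos_iff_eq_zero, mul_eq_zero,
    ENNReal.rpow_eq_zero_iff_of_pos hp, enorm_eq_zero, ENNReal.ofReal_eq_zero] at h1
  rcases h1 with h1 | h1
  · exact hN.ne' h1
  · exact absurd h1 (not_le.2 (by positivity))

lemma truncLog_mem_sobolevX {p θ N : ℝ} (hp : 1 < p) (hθ : -1 < θ) (hN : 0 ≤ N) :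
    truncLog N ∈ sobolevX p (p - 1) θ := by
  have hp0 : 0 < p := by linarith
  have hAC := fun a b (ha : 0 < a) (hab : a ≤ b) => absolutelyContinuousOnInterval_truncLog N ha hab
  refine ⟨hAC, ?_, ⟨?_, ?_⟩, (measurable_deriv _).aestronglyMeasurable, ?_⟩
  · refine tendsto_const_nhds.congr' ?_
    filter_upwards [eventually_ge_atTop 1] with r hr
    exact (truncLog_of_one_le hr).symm
  · have : Measurable (truncLog N) := by
      unfold truncLog
      fun_prop
    exact this.aestronglyMeasurable
  · exact (ENNReal.rpow_lt_top_iff_of_pos hp0).1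
      ((lpNorm_truncLog_le hp0 hθ hN).trans_lt ENNReal.ofReal_lt_top)
  · exact (ENNReal.rpow_lt_top_iff_of_pos hp0).1
      ((lpNorm_deriv_truncLog_le hp hN).trans_lt ENNReal.ofReal_lt_top)

/-- The lower bound for the subcritical supremum given by Moser's function with plateau `N`. -/
lemma le_TMSC {p θ μ N : ℝ} (hp : 1 < p) (hθ : -1 < θ) (hμ : 0 ≤ μ) (hN : 0 < N) :
    ENNReal.ofReal (omega (p - 1) * phi p (μ / muCrit (p - 1) θ * (θ + 1) * N) *
      Real.exp (-((θ + 1) * N)) / N ^ (p - 1)) ≤ TMSC p (p - 1) θ μ := by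
  have hp0 : 0 < p := by linarith
  have hp1 : 0 < p - 1 := by linarith
  have hθ1 : 0 < θ + 1 := by linarith
  have hω := omega_pos hθ
  have hωα : 0 < omega (p - 1) := omega_pos (by linarith)
  have hμc : 0 < muCrit (p - 1) θ := muCrit_pos (by linarith) hθ
  set c := (omega (p - 1) * N) ^ (-(1 / p)) with hc
  have hc0 : 0 < c := by positivity
  have hc1 : |c| ^ p = (omega (p - 1) * N)⁻¹ := by
    rw [abs_of_pos hc0, hc, ← Real.rpow_mul (by positivity), neg_mul, one_div_mul_cancel hp0.ne',
      Real.rpow_neg_one]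
  have hc2 : μ * c ^ (p / (p - 1)) * N ^ (p / (p - 1)) =
      μ / muCrit (p - 1) θ * (θ + 1) * N := by
    have hN1 : N ^ (p / (p - 1)) = N ^ (1 / (p - 1)) * N := by
      nth_rewrite 3 [← Real.rpow_one N]
      rw [← Real.rpow_add hN]
      congr 1
      field_simp
      ring
    rw [hc, ← Real.rpow_mul (by positivity), show -(1 / p) * (p / (p - 1)) = -(1 / (p - 1)) by
      field_simp, Real.rpow_neg (by positivity), Real.mul_rpow hωα.le hN.le, hN1, muCrit]
    have : 0 < omega (p - 1) ^ (1 / (p - 1)) := by positivity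
    have : 0 < N ^ (1 / (p - 1)) := by positivity
    field_simp
  have hX := truncLog_mem_sobolevX hp hθ hN.le
  have hvX := const_mul_comp_mul_mem_sobolevX hp0 c one_pos hX
  have hvB := lpNorm_rpow_const_mul_comp_mul hp0 θ c one_pos (truncLog N)
  have hvD := lpNorm_deriv_rpow_const_mul_comp_mul hp0 c one_pos (truncLog N)
  have hvF := expFunctional_const_mul_comp_mul p θ μ hc0.le one_pos (truncLog N)
  rw [hc1, Real.one_rpow, mul_one] at hvB
  rw [hc1] at hvD
  rw [Real.one_rpow, ENNReal.ofReal_one, one_mul] at hvF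
  set v := fun r => c * truncLog N (1 * r) with hv
  have hvmem : v ∈ {u | u ∈ sobolevX p (p - 1) θ ∧ lpNorm p θ u ≠ 0 ∧
      lpNorm p (p - 1) (deriv u) ≤ 1} := by
    refine ⟨hvX, fun h => ?_, ?_⟩
    · rw [h, ENNReal.zero_rpow_of_pos hp0, eq_comm, mul_eq_zero, ENNReal.ofReal_eq_zero,
        ENNReal.rpow_eq_zero_iff_of_pos hp0] at hvB
      rcases hvB with h1 | h1
      · exact absurd h1 (not_le.2 (by positivity))
      · exact lpNorm_truncLog_ne_zero hp0 hθ hN h1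
    · rw [← ENNReal.rpow_le_rpow_iff hp0, hvD, ENNReal.one_rpow]
      calc _ ≤ ENNReal.ofReal (omega (p - 1) * N)⁻¹ * ENNReal.ofReal (omega (p - 1) * N) := by
            gcongr
            exact lpNorm_deriv_truncLog_le hp hN.le
        _ = 1 := by
          rw [← ENNReal.ofReal_mul (by positivity), inv_mul_cancel₀ (by positivity),
            ENNReal.ofReal_one]
  have hB : lpNorm p θ v ^ p ≤
      ENNReal.ofReal (N ^ (p - 1) * (omega θ / (θ + 1)) / omega (p - 1)) := by
    rw [hvB]
    calc _ ≤ ENNReal.ofReal (omega (p - 1) * N)⁻¹ *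
          ENNReal.ofReal (N ^ p * (omega θ / (θ + 1))) := by
          gcongr
          exact lpNorm_truncLog_le hp0 hθ hN.le
      _ = _ := by
        rw [← ENNReal.ofReal_mul (by positivity), Real.rpow_sub hN, Real.rpow_one]
        congr 1
        field_simp
  have hF : ENNReal.ofReal (phi p (μ / muCrit (p - 1) θ * (θ + 1) * N)) *
      ENNReal.ofReal (omega θ * Real.exp (-((θ + 1) * N)) / (θ + 1)) ≤
        expFunctional p θ μ v := by
    rw [hvF]
    refine le_trans (le_of_eq ?_) (mul_lam_le_of_plateau hθ hN.le fun x =>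
      ENNReal.ofReal (phi p (μ * c ^ (p / (p - 1)) * |x| ^ (p / (p - 1)))))
    simp only [abs_of_pos hN, hc2]
  have hφ := phi_nonneg p (t := μ / muCrit (p - 1) θ * (θ + 1) * N) (by positivity)
  refine le_trans ?_ (le_iSup₂ (f := fun v (_ : v ∈ {u | u ∈ sobolevX p (p - 1) θ ∧
    lpNorm p θ u ≠ 0 ∧ lpNorm p (p - 1) (deriv u) ≤ 1}) =>
      expFunctional p θ μ v / lpNorm p θ v ^ p) v hvmem)
  refine le_trans (le_of_eq ?_) (ENNReal.div_le_div hF hB)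
  rw [← ENNReal.ofReal_mul hφ, ← ENNReal.ofReal_div_of_pos (by positivity)]
  congr 1
  field_simp

/-- Beyond the critical constant, the exponential growth of the functional on the plateau of Moser's
functions beats both the size `e^{-(θ+1)N}` of the plateau and the norms, polynomial in `N`. -/
theorem TMSC_eq_top {p θ μ : ℝ} (hp : 1 < p) (hθ : -1 < θ) (hμ : muCrit (p - 1) θ < μ) :
    TMSC p (p - 1) θ μ = ∞ := by
  have hθ1 : 0 < θ + 1 := by linarith
  have hωα : 0 < omega (p - 1) := omega_pos (by linarith)
  have hμc : 0 < muCrit (p - 1) θ := muCrit_pos (by linarith) hθ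
  have hμ0 : 0 < μ := hμc.trans hμ
  set κ := μ / muCrit (p - 1) θ * (θ + 1) with hκ
  have hκ0 : 0 < κ := by positivity
  have hκ1 : θ + 1 < κ := lt_mul_of_one_lt_left hθ1 ((one_lt_div hμc).2 hμ)
  have h1 : Tendsto (fun N : ℝ => phi p (κ * N) * Real.exp (-(κ * N))) atTop (𝓝 1) :=
    (tendsto_phi_mul_exp_neg p).comp (tendsto_id.const_mul_atTop hκ0)
  have h2 := tendsto_exp_mul_div_rpow_atTop (p - 1) (κ - (θ + 1)) (by linarith)
  have h3 := (h1.pos_mul_atTop one_pos h2).const_mul_atTop hωα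
  have h4 := ENNReal.tendsto_ofReal_nhds_top.2 h3
  refine top_unique (le_of_tendsto h4 ?_)
  filter_upwards [eventually_gt_atTop 0] with N hN
  refine le_trans (le_of_eq ?_) (le_TMSC hp hθ hμ0.le hN)
  rw [← hκ]
  congr 1
  rw [show (κ - (θ + 1)) * N = κ * N + -((θ + 1) * N) by ring, Real.exp_add, Real.exp_neg (κ * N)]
  have := Real.exp_pos (κ * N)
  field_simp

theorem TMC_eq_top {p θ σ : ℝ} (hp : 1 < p) (hθ : -1 < θ) (hσ : muCrit (p - 1) θ < σ) :
    TMC p (p - 1) θ σ = ∞ := by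
  have hμc : 0 < muCrit (p - 1) θ := muCrit_pos (by linarith) hθ
  obtain ⟨μ, h1, h2⟩ := exists_between hσ
  have hμ : 0 < μ := hμc.trans h1
  have hk : 0 < (μ / σ) ^ (p - 1) := Real.rpow_pos_of_pos (div_pos hμ (hμ.trans h2)) _
  have hk1 : (μ / σ) ^ (p - 1) < 1 :=
    Real.rpow_lt_one (div_pos hμ (hμ.trans h2)).le ((div_lt_one (hμ.trans h2)).2 h2) (by linarith)
  have h := mul_TMSC_le_TMC hp hθ hμ h2
  rw [TMSC_eq_top hp hθ h1, ENNReal.mul_top] at h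
  · exact top_unique h
  · rw [Ne, ENNReal.ofReal_eq_zero, not_le]
    exact div_pos (by linarith) hk

end TrudingerMoser

theorem theorem1p2 (p α θ : ℝ) (hp : 2 ≤ p) (hα : α = p - 1) (hθ : 0 ≤ θ) :
    (∀ σ : ℝ, 0 ≤ σ → σ ≤ TrudingerMoser.muCrit α θ → TrudingerMoser.TMC p α θ σ < ⊤) ∧
    (∀ σ : ℝ, TrudingerMoser.muCrit α θ < σ → TrudingerMoser.TMC p α θ σ = ⊤) ∧
    (∀ σ : ℝ, 0 ≤ σ → σ ≤ TrudingerMoser.muCrit α θ →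
      TrudingerMoser.TMC p α θ σ =
        ⨆ μ ∈ Ioo 0 σ,
          ENNReal.ofReal ((1 - (μ / σ) ^ (p - 1)) / (μ / σ) ^ (p - 1)) *
            TrudingerMoser.TMSC p α θ μ) := by
  subst hα
  have hp1 : 1 < p := by linarith
  have hθ1 : -1 < θ := by linarith
  refine ⟨fun σ hσ hσμ => ?_, fun σ hσ => TrudingerMoser.TMC_eq_top hp1 hθ1 hσ, fun σ hσ _ => ?_⟩
  · exact lt_of_le_of_lt (iSup₂_mono fun u _ => TrudingerMoser.expFunctional_mono hσ hσμ u)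
      (TrudingerMoser.TMC_muCrit_lt_top hp hθ)
  · rcases hσ.eq_or_lt with rfl | hσ
    · have h : TrudingerMoser.TMC p (p - 1) θ 0 = 0 := by
        simp [TrudingerMoser.TMC, TrudingerMoser.expFunctional, TrudingerMoser.phi_zero hp1]
      simp [h]
    · exact le_antisymm (TrudingerMoser.TMC_le_iSup_TMSC hp1 hσ)
        (iSup₂_le fun μ hμ => TrudingerMoser.mul_TMSC_le_TMC hp1 hθ1 hμ.1 hμ.2)
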